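/- Let $\mathcal H$ be a complex Hilbert space (scalar product conjugate-linear in the first variable) and let $q\in[-1,1]$. On the tensor powers $\mathcal H^{\otimes n}$, with $\mathcal H^{\otimes 0}=\mathbb C$, define $\lambda_0=\mathrm{id}$, $\lambda_1=\mathrm{id}$, $\lambda_2(g\otimes h)=g\otimes h+q\,h\otimes g$ and $\lambda_{n+2}=\mathbf 1^{\otimes n}\otimes\lambda_2$ for $n\ge1$. Let $\mathcal H_n$ be the Hilbert space obtained from $\mathcal H^{\otimes n}$ with the semi-inner product $\langle F,G\rangle_n=\langle F,\lambda_nG\rangle$ by dividing out its kernel and completing. The $(q,2)$-Fock space is the Hilbert space direct sum $\bigoplus_{n\ge0}\mathcal H_n$, with vacuum vector $\Phi=1\oplus0\oplus0\oplus\cdots$. For $f\in\mathcal H$, the creation operator $A^+(f)$ is the bounded linear operator with $A^+(f)\Phi=f$ and $A^+(f)F=f\otimes F$ for $F\in\mathcal H_n$, $n\ge 1$. Put $A(f)=(A^+(f))^*$ and $Q(f)=A(f)+A^+(f)$, and let $L_{q,f}$ be the vacuum distribution of the bounded self-adjoint operator $Q(f)$, i.e. the regular Borel measure on $\mathbb R$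 with $\int g\,dL_{q,f}=\langle\Phi,g(Q(f))\Phi\rangle$ for every continuous compactly supported $g:\mathbb R\to\mathbb R$. **Theorem.** Let $q\in(-1,1]$ and $0\ne f\in\mathcal H$, and put $$l_{q,f}(x)=\frac{(1+q)\|f\|^2}{2\pi}\cdot\frac{\sqrt{4\|f\|^2-x^2}}{\|f\|^4+q(q+3)\|f\|^2x^2-qx^4}\;\chi_{(-2\|f\|,\,2\|f\|)}(x),\qquad x\in\mathbb R .$$ Then $l_{q,f}$ is a nonnegative measurable function, $L_{q,f}$ is a probability measure, and: 1. if $q\in(-1,\tfrac12]$, then $L_{q,f}$ is absolutely continuous (with respect to Lebesgue measure) and $l_{q,f}$ is its probability density function; in particular $\int l_{q,f}\,dx=1$; 2. if $q\in(\tfrac12,1]$, then $l_{q,f}$ is not a probability density function, namely $\int l_{q,f}\,dx\neq1$, and for every Borel set $B\subseteq\mathbb R$ $$L_{q,f}(B)=\int_B l_{q,f}(x)\,dx+\frac12\Bigl(1-\frac{1+q}{\sqrt{q(q+4)}}\Bigr)\bigl(\delta_{-2\|f\|\sqrt{a_1}}+\delta_{2\|f\|\sqrt{a_1}}\bigr)(B),$$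 where, with $a=1+q$, $a_1=\frac18\Bigl(\sqrt{(a+2)^2+\frac4{a-1}}+a+2\Bigr)$. -/

import Mathlib

open scoped TensorProduct ENNReal InnerProductSpace CompactlySupported
open MeasureTheory

noncomputable section

namespace Q2Fock

universe u

/-! ### Tensor powers of a Hilbert space -/

/-- A bundled complex inner product space, used to define tensor powers by recursion. -/
structure HilbObj where
  carrier : Type u
  [normed : NormedAddCommGroup carrier]
  [inner : InnerProductSpace ℂ carrier]

attribute [instance] HilbObj.normed HilbObj.inner

/-- The standard inner product on a universe-lifted copy of `ℂ`. -/
@[reducible]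
def innerULift : InnerProductSpace ℂ (ULift.{u} ℂ) where
  inner x y := inner ℂ x.down y.down
  norm_sq_eq_re_inner x := norm_sq_eq_re_inner (𝕜 := ℂ) x.down
  conj_inner_symm x y := inner_conj_symm x.down y.down
  add_left x y z := inner_add_left x.down y.down z.down
  smul_left x y r := inner_smul_left x.down y.down r

section

variable (H : Type u) [NormedAddCommGroup H] [InnerProductSpace ℂ H]

/-- `H^{⊗0} = ℂ` and `H^{⊗(n+1)} = H ⊗ H^{⊗n}` with the standard tensor scalar product. -/
def tensorPowObj : ℕ → HilbObj.{u}
  | 0 => @HilbObj.mk (ULift.{u} ℂ) inferInstance innerULift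
  | n + 1 => HilbObj.mk (H ⊗[ℂ] (tensorPowObj n).carrier)

/-- The `n`-th (algebraic) tensor power of `H`. -/
def TensorPow (n : ℕ) : Type u := (tensorPowObj H n).carrier

instance (n : ℕ) : NormedAddCommGroup (TensorPow H n) := (tensorPowObj H n).normed

instance (n : ℕ) : InnerProductSpace ℂ (TensorPow H n) := (tensorPowObj H n).inner

/-- `H^{⊗0}` is `ℂ` (by definition). -/
def tensorZero : ULift.{u} ℂ ≃ₗ[ℂ] TensorPow H 0 where
  toFun x := x
  invFun x := x
  map_add' _ _ := rfl
  map_smul' _ _ := rfl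
  left_inv _ := rfl
  right_inv _ := rfl

/-- `H^{⊗(n+1)}` is `H ⊗ H^{⊗n}` (by definition). -/
def tensorSucc (n : ℕ) : H ⊗[ℂ] TensorPow H n ≃ₗᵢ[ℂ] TensorPow H (n + 1) where
  toFun x := x
  invFun x := x
  map_add' _ _ := rfl
  map_smul' _ _ := rfl
  left_inv _ := rfl
  right_inv _ := rfl
  norm_map' _ := rfl

/-- The unit vector `1 ∈ ℂ = H^{⊗0}`. -/
def tensorOne : TensorPow H 0 := tensorZero H (ULift.up 1)

variable {H} in
/-- Tensoring on the left with `f`, as a linear map `H^{⊗n} → H^{⊗(n+1)}`, `F ↦ f ⊗ F`. -/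
def tensorLeft (f : H) (n : ℕ) : TensorPow H n →ₗ[ℂ] TensorPow H (n + 1) :=
  (tensorSucc H n).toLinearEquiv.toLinearMap ∘ₗ TensorProduct.mk ℂ H (TensorPow H n) f

/-- The flip `f ⊗ g ↦ g ⊗ f` of the two factors of `H^{⊗2} = H ⊗ (H ⊗ ℂ)`. -/
def flipTwo : TensorPow H 2 ≃ₗᵢ[ℂ] TensorPow H 2 :=
  let e : H ⊗[ℂ] (H ⊗[ℂ] TensorPow H 0) ≃ₗᵢ[ℂ] TensorPow H 2 :=
    ((tensorSucc H 0).lTensor H).trans (tensorSucc H 1)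
  e.symm.trans
    ((((TensorProduct.assocIsometry ℂ H H (TensorPow H 0)).symm.trans
      ((TensorProduct.commIsometry ℂ H H).rTensor (TensorPow H 0))).trans
      (TensorProduct.assocIsometry ℂ H H (TensorPow H 0))).trans e)

/-- The operators `λ_n` on `H^{⊗n}`: `λ_0` and `λ_1` are the identity,
`λ_2 (f ⊗ g) = f ⊗ g + q g ⊗ f`, and `λ_{n+1} = 1 ⊗ λ_n` for `n ≥ 2`
(so that `λ_{n+2} = 1^{⊗n} ⊗ λ_2`). -/
def lam (q : ℝ) : ∀ n : ℕ, TensorPow H n →ₗ[ℂ] TensorPow H n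
  | 0 => LinearMap.id
  | 1 => LinearMap.id
  | 2 => LinearMap.id + (q : ℂ) • (flipTwo H).toLinearEquiv.toLinearMap
  | n + 3 =>
    (tensorSucc H (n + 2)).toLinearEquiv.toLinearMap ∘ₗ
      (lam q (n + 2)).lTensor H ∘ₗ (tensorSucc H (n + 2)).symm.toLinearEquiv.toLinearMap

/-- The exchange of the last two factors of `H^{⊗(n+2)}`. -/
def flipLast : ∀ n : ℕ, TensorPow H (n + 2) ≃ₗᵢ[ℂ] TensorPow H (n + 2)
  | 0 => flipTwo H
  | n + 1 =>
    ((tensorSucc H (n + 2)).symm.trans ((flipLast n).lTensor H)).trans (tensorSucc H (n + 2))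

variable {H}

theorem tensorLeft_apply (f : H) (n : ℕ) (F : TensorPow H n) :
    tensorLeft f n F = tensorSucc H n (f ⊗ₜ[ℂ] F) := rfl

theorem inner_tensorLeft (f g : H) (n : ℕ) (F G : TensorPow H n) :
    inner ℂ (tensorLeft f n F) (tensorLeft g n G) = inner ℂ f g * inner ℂ F G := by
  rw [tensorLeft_apply, tensorLeft_apply, LinearIsometryEquiv.inner_map_map,
    TensorProduct.inner_tmul]

theorem norm_tensorLeft (f : H) (n : ℕ) (F : TensorPow H n) :
    ‖tensorLeft f n F‖ = ‖f‖ * ‖F‖ := by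
  rw [tensorLeft_apply, LinearIsometryEquiv.norm_map, TensorProduct.norm_tmul]

theorem flipTwo_tensorLeft (f g : H) (c : TensorPow H 0) :
    flipTwo H (tensorLeft f 1 (tensorLeft g 0 c)) = tensorLeft g 1 (tensorLeft f 0 c) := rfl

theorem tensorPow_induction {n : ℕ} {p : TensorPow H (n + 1) → Prop}
    (tmul : ∀ (f : H) (F : TensorPow H n), p (tensorLeft f n F))
    (add : ∀ x y, p x → p y → p (x + y)) (x : TensorPow H (n + 1)) : p x := by
  obtain ⟨y, rfl⟩ := (tensorSucc H n).surjective x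
  induction y using TensorProduct.induction_on with
  | zero => simpa [tensorLeft_apply] using tmul 0 0
  | tmul f F => exact tmul f F
  | add a b ha hb => rw [map_add]; exact add _ _ ha hb

theorem flipTwo_flipTwo (x : TensorPow H 2) : flipTwo H (flipTwo H x) = x := by
  induction x using tensorPow_induction with
  | tmul f F =>
    induction F using tensorPow_induction with
    | tmul g c => rw [flipTwo_tensorLeft, flipTwo_tensorLeft]
    | add a b ha hb => rw [map_add, map_add, map_add, ha, hb]
  | add a b ha hb => rw [map_add, map_add, ha, hb]

theorem flipLast_tensorLeft (f : H) (n : ℕ) (x : TensorPow H (n + 2)) :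
    flipLast H (n + 1) (tensorLeft f (n + 2) x) = tensorLeft f (n + 2) (flipLast H n x) := rfl

theorem flipLast_flipLast (n : ℕ) (x : TensorPow H (n + 2)) :
    flipLast H n (flipLast H n x) = x := by
  induction n with
  | zero => exact flipTwo_flipTwo x
  | succ n ih =>
    induction x using tensorPow_induction with
    | tmul f F => rw [flipLast_tensorLeft, flipLast_tensorLeft, ih]
    | add a b ha hb => rw [map_add, map_add, ha, hb]

theorem lam_tensorLeft (q : ℝ) (f : H) (n : ℕ) (x : TensorPow H (n + 2)) :
    lam H q (n + 3) (tensorLeft f (n + 2) x) = tensorLeft f (n + 2) (lam H q (n + 2) x) := rfl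

theorem lam_add_two (q : ℝ) (n : ℕ) (x : TensorPow H (n + 2)) :
    lam H q (n + 2) x = x + (q : ℂ) • flipLast H n x := by
  induction n with
  | zero => rfl
  | succ n ih =>
    induction x using tensorPow_induction with
    | tmul f F => rw [lam_tensorLeft, flipLast_tensorLeft, ih, map_add, map_smul]
    | add a b ha hb => rw [map_add, map_add, ha, hb, smul_add]; abel

theorem inner_flipLast_right (n : ℕ) (x y : TensorPow H (n + 2)) :
    inner ℂ x (flipLast H n y) = inner ℂ (flipLast H n x) y := by
  rw [← LinearIsometryEquiv.inner_map_map (flipLast H n), flipLast_flipLast]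

theorem lam_symm (q : ℝ) (n : ℕ) (x y : TensorPow H n) :
    inner ℂ x (lam H q n y) = inner ℂ (lam H q n x) y := by
  match n, x, y with
  | 0, x, y => rfl
  | 1, x, y => rfl
  | n + 2, x, y =>
    rw [lam_add_two, lam_add_two, inner_add_left, inner_add_right, inner_smul_left,
      inner_smul_right, inner_flipLast_right, Complex.conj_ofReal]

theorem lam_nonneg (q : Set.Icc (-1 : ℝ) 1) (n : ℕ) (x : TensorPow H n) :
    0 ≤ (inner ℂ x (lam H q n x)).re := by
  match n, x with
  | 0, x => exact inner_self_nonneg (𝕜 := ℂ) (x := x)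
  | 1, x => exact inner_self_nonneg (𝕜 := ℂ) (x := x)
  | n + 2, x =>
    have h1 : ‖inner ℂ x (flipLast H n x)‖ ≤ ‖x‖ * ‖x‖ := by
      simpa using norm_inner_le_norm (𝕜 := ℂ) x (flipLast H n x)
    have h2 := (Complex.abs_re_le_norm (inner ℂ x (flipLast H n x))).trans h1
    have h3 : (inner ℂ x x).re = ‖x‖ * ‖x‖ := inner_self_eq_norm_mul_norm (𝕜 := ℂ) x
    rw [lam_add_two, inner_add_right, inner_smul_right, Complex.add_re, Complex.re_ofReal_mul, h3]
    obtain ⟨q, hq1, hq2⟩ := q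
    rw [abs_le] at h2
    simp only
    nlinarith [mul_nonneg (sub_nonneg.2 hq2) (sub_nonneg.2 h2.1),
      mul_nonneg (sub_nonneg.2 hq2) (sub_nonneg.2 h2.2),
      mul_nonneg (sub_nonneg.2 hq1) (sub_nonneg.2 h2.1),
      mul_nonneg (sub_nonneg.2 hq1) (sub_nonneg.2 h2.2)]

end

/-! ### The particle spaces -/

section

variable (q : Set.Icc (-1 : ℝ) 1) (H : Type u) [NormedAddCommGroup H] [InnerProductSpace ℂ H]

/-- The vector space `H^{⊗n}`, to be equipped with the semi-inner product
`⟨F, G⟩_n = ⟨F, λ_n G⟩`. -/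
def PreParticle (_q : Set.Icc (-1 : ℝ) 1) (H : Type u) [NormedAddCommGroup H]
    [InnerProductSpace ℂ H] (n : ℕ) : Type u := TensorPow H n

/-- The semi-inner product `⟨F, G⟩_n = ⟨F, λ_n G⟩` on `H^{⊗n}`. -/
@[reducible]
def preParticleCore (n : ℕ) : PreInnerProductSpace.Core ℂ (TensorPow H n) where
  inner F G := inner ℂ F (lam H q n G)
  conj_inner_symm F G := by rw [inner_conj_symm, lam_symm]
  re_inner_nonneg F := lam_nonneg q n F
  add_left F G K := inner_add_left F G _
  smul_left F G r := inner_smul_left F _ r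

instance (n : ℕ) : SeminormedAddCommGroup (PreParticle q H n) :=
  @InnerProductSpace.Core.toSeminormedAddCommGroup ℂ (TensorPow H n) _ _ _ (preParticleCore q H n)

instance (n : ℕ) : InnerProductSpace ℂ (PreParticle q H n) :=
  InnerProductSpace.ofCore (preParticleCore q H n)

/-- The identity map from `H^{⊗n}` with its standard structure to `H^{⊗n}` with the
semi-inner product `⟨·, λ_n ·⟩`. -/
def toPre (n : ℕ) : TensorPow H n ≃ₗ[ℂ] PreParticle q H n where
  toFun x := x
  invFun x := x
  map_add' _ _ := rfl
  map_smul' _ _ := rfl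
  left_inv _ := rfl
  right_inv _ := rfl

variable {H} in
theorem inner_toPre (n : ℕ) (F G : TensorPow H n) :
    inner ℂ (toPre q H n F) (toPre q H n G) = inner ℂ F (lam H q n G) := rfl

/-- The `n`-particle space: the Hilbert space obtained from `H^{⊗n}` with the semi-inner product
`⟨·, λ_n ·⟩` by dividing out the kernel and completing (`UniformSpace.Completion` is the
Hausdorff completion, so it does both). For `n = 0` it is `ℂ`. -/
abbrev ParticleSpace (n : ℕ) : Type u := UniformSpace.Completion (PreParticle q H n)

/-- The class of `F ∈ H^{⊗n}` in the `n`-particle space. -/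
def toParticle (n : ℕ) : TensorPow H n →ₗ[ℂ] ParticleSpace q H n :=
  (UniformSpace.Completion.toComplL (𝕜 := ℂ) (E := PreParticle q H n)).toLinearMap ∘ₗ
    (toPre q H n).toLinearMap

/-- The `(q,2)`-Fock space: the Hilbert space direct sum of the `n`-particle spaces. -/
abbrev Fock : Type u := lp (fun n : ℕ => ParticleSpace q H n) 2

/-- The vacuum vector `1 ⊕ 0 ⊕ 0 ⊕ ⋯`. -/
def vacuum : Fock q H := lp.single 2 0 (toParticle q H 0 (tensorOne H))

/-! ### Creation, annihilation and field operators -/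

variable {H}

theorem norm_toPre_tensorLeft_le (f : H) (n : ℕ) (F : TensorPow H n) :
    ‖toPre q H (n + 1) (tensorLeft f n F)‖ ≤ (Real.sqrt 2 * ‖f‖) * ‖toPre q H n F‖ := by
  have key : ‖toPre q H (n + 1) (tensorLeft f n F)‖ ^ 2 ≤ 2 * ‖f‖ ^ 2 * ‖toPre q H n F‖ ^ 2 := by
    rw [norm_sq_eq_re_inner (𝕜 := ℂ) (toPre q H (n + 1) (tensorLeft f n F)),
      norm_sq_eq_re_inner (𝕜 := ℂ) (toPre q H n F), inner_toPre, inner_toPre]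
    match n, F with
    | 0, F =>
      change RCLike.re (inner ℂ (tensorLeft f 0 F) (tensorLeft f 0 F)) ≤
        _ * RCLike.re (inner ℂ F F)
      rw [← norm_sq_eq_re_inner, ← norm_sq_eq_re_inner, norm_tensorLeft]
      nlinarith [sq_nonneg (‖f‖ * ‖F‖)]
    | 1, F =>
      change _ ≤ _ * RCLike.re (inner ℂ F F)
      have h1 : ‖inner ℂ (tensorLeft f 1 F) (flipLast H 0 (tensorLeft f 1 F))‖ ≤
          ‖tensorLeft f 1 F‖ * ‖tensorLeft f 1 F‖ := by
        simpa using norm_inner_le_norm (𝕜 := ℂ) (tensorLeft f 1 F)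
          (flipLast H 0 (tensorLeft f 1 F))
      have h2 := (Complex.abs_re_le_norm _).trans h1
      have h3 : (inner ℂ (tensorLeft f 1 F) (tensorLeft f 1 F)).re =
          ‖tensorLeft f 1 F‖ * ‖tensorLeft f 1 F‖ :=
        inner_self_eq_norm_mul_norm (𝕜 := ℂ) (tensorLeft f 1 F)
      rw [lam_add_two, ← norm_sq_eq_re_inner, inner_add_right, inner_smul_right,
        RCLike.re_eq_complex_re, Complex.add_re, Complex.re_ofReal_mul, h3]
      rw [norm_tensorLeft, abs_le] at h2
      rw [norm_tensorLeft]
      obtain ⟨q, hq1, hq2⟩ := q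
      simp only
      nlinarith [mul_nonneg (sub_nonneg.2 hq2) (sub_nonneg.2 h2.1),
        mul_nonneg (sub_nonneg.2 hq2) (sub_nonneg.2 h2.2),
        mul_nonneg (sub_nonneg.2 hq1) (sub_nonneg.2 h2.1),
        mul_nonneg (sub_nonneg.2 hq1) (sub_nonneg.2 h2.2)]
    | n + 2, F =>
      have h0 := lam_nonneg q (n + 2) F
      have h1 : (inner ℂ f f) = ((‖f‖ ^ 2 : ℝ) : ℂ) := by
        rw [inner_self_eq_norm_sq_to_K]; norm_cast
      rw [lam_tensorLeft, inner_tensorLeft, h1, RCLike.re_eq_complex_re, Complex.re_ofReal_mul]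
      nlinarith [mul_nonneg (sq_nonneg ‖f‖) h0]
  refine (sq_le_sq₀ (norm_nonneg _) (by positivity)).1 ?_
  rw [mul_pow, mul_pow, Real.sq_sqrt (by norm_num)]
  exact key

/-- The map `F ↦ f ⊗ F` from `H^{⊗n}` to `H^{⊗(n+1)}`, bounded for the seminorms of
`⟨·, λ_n ·⟩` and `⟨·, λ_{n+1} ·⟩`. -/
def preCreation (f : H) (n : ℕ) : PreParticle q H n →L[ℂ] PreParticle q H (n + 1) :=
  LinearMap.mkContinuous
    ((toPre q H (n + 1)).toLinearMap ∘ₗ tensorLeft f n ∘ₗ (toPre q H n).symm.toLinearMap)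
    (Real.sqrt 2 * ‖f‖) (fun F => norm_toPre_tensorLeft_le q f n ((toPre q H n).symm F))

/-- The map `F ↦ f ⊗ F` from the `n`-particle space to the `(n+1)`-particle space. -/
def particleCreation (f : H) (n : ℕ) : ParticleSpace q H n →L[ℂ] ParticleSpace q H (n + 1) :=
  (preCreation q f n).completion

theorem particleCreation_toParticle (f : H) (n : ℕ) (F : TensorPow H n) :
    particleCreation q f n (toParticle q H n F) = toParticle q H (n + 1) (tensorLeft f n F) :=
  ContinuousLinearMap.completion_apply_coe _ _

theorem norm_particleCreation_le (f : H) (n : ℕ) (x : ParticleSpace q H n) :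
    ‖particleCreation q f n x‖ ≤ (Real.sqrt 2 * ‖f‖) * ‖x‖ := by
  induction x using UniformSpace.Completion.induction_on with
  | hp => exact isClosed_le (by fun_prop) (by fun_prop)
  | ih F =>
    rw [particleCreation, ContinuousLinearMap.completion_apply_coe, UniformSpace.Completion.norm_coe,
      UniformSpace.Completion.norm_coe]
    exact norm_toPre_tensorLeft_le q f n ((toPre q H n).symm F)

/-- The components of `A⁺(f) x`: zero in degree `0` and `f ⊗ x_n` in degree `n + 1`. -/
def creationFun (f : H) (x : Fock q H) : ∀ n, ParticleSpace q H n
  | 0 => 0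
  | n + 1 => particleCreation q f n (x n)

theorem creation_bound (f : H) (x : Fock q H) :
    Memℓp (creationFun q f x) 2 ∧
      ∑' n, ‖creationFun q f x n‖ ^ 2 ≤ (Real.sqrt 2 * ‖f‖ * ‖x‖) ^ 2 := by
  have hx : Summable fun n => ‖x n‖ ^ 2 := by
    have := (lp.memℓp x).summable (by norm_num)
    simpa using this
  have hnx : ‖x‖ ^ 2 = ∑' n, ‖x n‖ ^ 2 := by
    have := lp.norm_rpow_eq_tsum (p := 2) (by norm_num) x
    simpa using this
  have hle : ∀ n, ‖creationFun q f x (n + 1)‖ ^ 2 ≤ (Real.sqrt 2 * ‖f‖) ^ 2 * ‖x n‖ ^ 2 := by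
    intro n
    rw [← mul_pow]
    exact pow_le_pow_left₀ (norm_nonneg _) (norm_particleCreation_le q f n (x n)) 2
  have hs1 : Summable fun n => ‖creationFun q f x (n + 1)‖ ^ 2 :=
    Summable.of_nonneg_of_le (fun n => by positivity) hle (hx.mul_left _)
  have hs : Summable fun n => ‖creationFun q f x n‖ ^ 2 := (summable_nat_add_iff 1).1 hs1
  refine ⟨memℓp_gen (by simpa using hs), ?_⟩
  rw [hs.tsum_eq_zero_add, mul_pow _ ‖x‖, hnx, ← tsum_mul_left]
  have h0 : ‖creationFun q f x 0‖ ^ 2 = 0 := by simp [creationFun]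
  rw [h0, zero_add]
  exact hs1.tsum_le_tsum hle (hx.mul_left _)

/-- The creation operator `A⁺(f)`: the bounded linear operator on the Fock space with
`A⁺(f) Φ = f` and `A⁺(f) F = f ⊗ F` for `F` in the `n`-particle space. -/
def creation (f : H) : Fock q H →L[ℂ] Fock q H :=
  LinearMap.mkContinuous
    { toFun := fun x => ⟨creationFun q f x, (creation_bound q f x).1⟩
      map_add' := fun x y => by
        ext n
        match n with
        | 0 => exact (add_zero (0 : ParticleSpace q H 0)).symm
        | n + 1 => exact map_add (particleCreation q f n) (x n) (y n)
      map_smul' := fun c x => by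
        ext n
        match n with
        | 0 => exact (smul_zero (A := ParticleSpace q H 0) c).symm
        | n + 1 => exact map_smul (particleCreation q f n) c (x n) }
    (Real.sqrt 2 * ‖f‖) (fun x => by
      refine (sq_le_sq₀ (norm_nonneg _) (by positivity)).1 ?_
      refine le_trans (le_of_eq ?_) (creation_bound q f x).2
      have := lp.norm_rpow_eq_tsum (p := 2) (by norm_num)
        (⟨creationFun q f x, (creation_bound q f x).1⟩ : Fock q H)
      simpa using this)

/-- The annihilation operator `A(f) = (A⁺(f))^*`. -/
def annihilation (f : H) : Fock q H →L[ℂ] Fock q H := ContinuousLinearMap.adjoint (creation q f)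

/-- The field operator `Q(f) = A(f) + A⁺(f)`. -/
def field (f : H) : Fock q H →L[ℂ] Fock q H := annihilation q f + creation q f

end

/-! ### Distribution of a bounded self-adjoint operator in a vector state -/

section

variable {K : Type*} [NormedAddCommGroup K] [InnerProductSpace ℂ K] [CompleteSpace K]

/-- The positive linear functional `g ↦ ⟨Φ, g(T) Φ⟩` on `C_c(ℝ)`, where `g(T)` is the
continuous functional calculus of the self-adjoint operator `T`. -/
def vectorStateFunctional (T : K →L[ℂ] K) (Φ : K) : C_c(ℝ, ℝ) →ₚ[ℝ] ℝ :=
  PositiveLinearMap.mk₀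
    { toFun := fun g => (inner ℂ Φ (cfc (g : ℝ → ℝ) T Φ)).re
      map_add' := fun g h => by
        have : cfc (⇑(g + h)) T = cfc (⇑g) T + cfc (⇑h) T :=
          cfc_add (R := ℝ) T g h g.continuous.continuousOn h.continuous.continuousOn
        rw [this, add_apply, inner_add_right, Complex.add_re]
      map_smul' := fun c g => by
        have : cfc (⇑(c • g)) T = c • cfc (⇑g) T :=
          cfc_smul (R := ℝ) c g T g.continuous.continuousOn
        rw [this, smul_apply, inner_smul_right_eq_smul]
        simp }
    (fun g hg => by
      have h : 0 ≤ cfc (⇑g) T := cfc_nonneg (fun x _ => hg x)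
      exact ((ContinuousLinearMap.nonneg_iff_isPositive _).1 h).re_inner_nonneg_right Φ)

/-- The distribution of the bounded self-adjoint operator `T` in the vector state of `Φ`: the
regular Borel measure `L` on `ℝ` with `∫ g dL = ⟨Φ, g(T) Φ⟩` for all `g ∈ C_c(ℝ)`. -/
def distribution (T : K →L[ℂ] K) (Φ : K) : Measure ℝ :=
  RealRMK.rieszMeasure (vectorStateFunctional T Φ)

theorem integral_distribution (T : K →L[ℂ] K) (Φ : K) (g : C_c(ℝ, ℝ)) :
    ∫ x, g x ∂(distribution T Φ) = (inner ℂ Φ (cfc (g : ℝ → ℝ) T Φ)).re :=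
  RealRMK.integral_rieszMeasure (vectorStateFunctional T Φ) g

end

section

variable {H : Type u} [NormedAddCommGroup H] [InnerProductSpace ℂ H]

theorem isSelfAdjoint_field (q : Set.Icc (-1 : ℝ) 1) (f : H) : IsSelfAdjoint (field q f) := by
  rw [field, annihilation, ← ContinuousLinearMap.star_eq_adjoint]
  exact IsSelfAdjoint.star_add_self _

/-- The law `L_{q,f}`: the vacuum distribution of the field operator `Q(f)`. -/
def fieldLaw (q : Set.Icc (-1 : ℝ) 1) (f : H) : Measure ℝ := distribution (field q f) (vacuum q H)

/-- The function `l_{q,f}`; it depends on `f` only through `s = ‖f‖`. -/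
def density (q s : ℝ) : ℝ → ℝ :=
  (Set.Ioo (-2 * s) (2 * s)).indicator fun x =>
    (1 + q) * s ^ 2 / (2 * Real.pi) *
      (Real.sqrt (4 * s ^ 2 - x ^ 2) / (s ^ 4 + q * (q + 3) * s ^ 2 * x ^ 2 - q * x ^ 4))

/-- The constant `a₁ = (√((a + 2)² + 4 / (a - 1)) + a + 2) / 8`, for `a > 1`. -/
def aOne (a : ℝ) : ℝ := (Real.sqrt ((a + 2) ^ 2 + 4 / (a - 1)) + a + 2) / 8

end

end Q2Fock

end

/-! The field operator is a Jacobi matrix on the classes `u_n` of the powers of `f`: with `s = ‖f‖`,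
`Q u_{n+1} = u_{n+2} + ω_n u_n`, where every `ω_n` is `s²` except `ω_1 = (1 + q) s²`. Hence the
monic polynomials `P_n` with coefficients `ω` satisfy `P_n(Q) Φ = u_n`, and `⟨Φ, P_n(Q) Φ⟩ = 0` for
`n ≥ 1`. Since the `P_n` span all polynomials and a law of bounded support is determined by its
moments (`distribution_eq_of_moments`), it suffices to exhibit a finite measure of bounded support
and total mass `1` that annihilates every `P_n`, `n ≥ 1`.

Put `x = 2 s cos θ`, `z = exp (iθ)` and `h(z) = 1 - q z² - q z⁴`. The denominator of the density
becomes `s⁴ |h(z)|²`, and up to explicit constants the integrals of the `P_n` against the density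
are the numbers `c_k = ∫ sin θ Im (zᵏ / h(z)) dθ` (`sinCoeff`). Multiplying by `h` gives `c_k - q
c_{k+2} - q c_{k+4} = ±π/2` at `k = ±1` and `0` elsewhere (`sinCoeff_recurrence`), while the
Riemann–Lebesgue lemma gives `c_k → 0` in both directions (`tendsto_sinCoeff`). No residues are
computed: decay alone selects the solution.

Write `1 - q w - q w² = (1 - α w)(1 - β w)`. If `q ≤ 1/2`, both roots have modulus at most `1`, so
decay forces `c_k = 0` for `k ≥ 2` (`sinCoeff_eq_zero`), and the density is the law. If `q > 1/2`,
one root `α` exceeds `1` and a geometric tail survives (`sinCoeff_of_half_lt`). At the points `±s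
(√α + 1/√α)` the polynomials decay at the same geometric rate (`eval_atomPoint_jacobiPoly_succ`), so
two equal atoms there cancel the tail and supply the missing mass. -/

namespace Q2Fock

universe u

/-! ### The field operator as a Jacobi matrix on the powers of `f` -/

section FockVectors

variable {H : Type u} [NormedAddCommGroup H] [InnerProductSpace ℂ H]

/-- The tensor power `f ⊗ ⋯ ⊗ f`. -/
noncomputable def tensorPower (f : H) : ∀ n : ℕ, TensorPow H n
  | 0 => tensorOne H
  | n + 1 => tensorLeft f n (tensorPower f n)

theorem flipLast_tensorPower (f : H) (n : ℕ) :
    flipLast H n (tensorPower f (n + 2)) = tensorPower f (n + 2) := by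
  induction n with
  | zero => exact flipTwo_tensorLeft f f _
  | succ n ih =>
    change flipLast H (n + 1) (tensorLeft f (n + 2) (tensorPower f (n + 2))) = _
    rw [flipLast_tensorLeft, ih]
    rfl

theorem lam_tensorPower (q : ℝ) (f : H) (n : ℕ) :
    lam H q (n + 2) (tensorPower f (n + 2)) = ((1 + q : ℝ) : ℂ) • tensorPower f (n + 2) := by
  rw [lam_add_two, flipLast_tensorPower]
  push_cast
  rw [add_smul, one_smul]

/-- The Jacobi coefficients of the field operator `Q(f)` in the vacuum state, with `s = ‖f‖`. -/
def jacobiCoeff (q s : ℝ) : ℕ → ℝ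
  | 0 => s ^ 2
  | 1 => (1 + q) * s ^ 2
  | _ + 2 => s ^ 2

/-- This is where the Jacobi coefficients come from. For `n ≥ 2` the operator `λ_{n+1} = 1 ⊗ λ_n`
leaves the first factor alone; only in passing from `λ_1 = id` to `λ_2` does the flip act on the new
factor, and `f ⊗ f` is its eigenvector, whence the single factor `1 + q`. -/
theorem inner_tensorPower_lam_tensorLeft (q : ℝ) (f : H) (n : ℕ) (F : TensorPow H n) :
    inner ℂ (tensorPower f (n + 1)) (lam H q (n + 1) (tensorLeft f n F)) =
      (jacobiCoeff q ‖f‖ n : ℂ) * inner ℂ (tensorPower f n) (lam H q n F) := by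
  have hf : (inner ℂ f f : ℂ) = ((‖f‖ ^ 2 : ℝ) : ℂ) := by
    rw [inner_self_eq_norm_sq_to_K]; norm_cast
  match n, F with
  | 0, F =>
    change inner ℂ (tensorLeft f 0 (tensorOne H)) (tensorLeft f 0 F) = _ * inner ℂ (tensorOne H) F
    rw [inner_tensorLeft, hf]
    rfl
  | 1, F =>
    rw [lam_symm, lam_tensorPower, inner_smul_left, Complex.conj_ofReal]
    change _ * inner ℂ (tensorLeft f 1 (tensorPower f 1)) (tensorLeft f 1 F) =
      _ * inner ℂ (tensorPower f 1) F
    rw [inner_tensorLeft, hf, ← mul_assoc, jacobiCoeff, ← Complex.ofReal_mul]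
  | n + 2, F =>
    change inner ℂ (tensorLeft f (n + 2) (tensorPower f (n + 2)))
      (tensorLeft f (n + 2) (lam H q (n + 2) F)) = _
    rw [inner_tensorLeft, hf]
    rfl

variable (q : Set.Icc (-1 : ℝ) 1)

/-- The class of `f ⊗ ⋯ ⊗ f` in the Fock space. -/
noncomputable def fockPower (f : H) (n : ℕ) : Fock q H :=
  lp.single 2 n (toParticle q H n (tensorPower f n))

theorem fockPower_zero (f : H) : fockPower q f 0 = vacuum q H := rfl

theorem inner_toParticle (n : ℕ) (F G : TensorPow H n) :
    inner ℂ (toParticle q H n F) (toParticle q H n G) = inner ℂ F (lam H q n G) :=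
  UniformSpace.Completion.inner_coe (𝕜 := ℂ) (toPre q H n F) (toPre q H n G)

theorem creation_apply_succ (f : H) (x : Fock q H) (n : ℕ) :
    creation q f x (n + 1) = particleCreation q f n (x n) := rfl

theorem creation_fockPower (f : H) (n : ℕ) :
    creation q f (fockPower q f n) = fockPower q f (n + 1) := by
  ext k : 2
  match k with
  | 0 =>
    change (0 : ParticleSpace q H 0) = _
    rw [fockPower, lp.single_apply_ne]
    simp
  | k + 1 =>
    rw [creation_apply_succ, fockPower, fockPower]
    by_cases h : k = n
    · subst h
      rw [lp.single_apply_self, lp.single_apply_self, particleCreation_toParticle]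
      rfl
    · rw [lp.single_apply_ne _ _ _ h, lp.single_apply_ne _ _ _ (by simpa using h), map_zero]

theorem inner_particleCreation (f : H) (n : ℕ) (x : ParticleSpace q H n) :
    inner ℂ (toParticle q H (n + 1) (tensorPower f (n + 1))) (particleCreation q f n x) =
      (jacobiCoeff q ‖f‖ n : ℂ) * inner ℂ (toParticle q H n (tensorPower f n)) x := by
  induction x using UniformSpace.Completion.induction_on with
  | hp => exact isClosed_eq (by fun_prop) (by fun_prop)
  | ih F =>
    have h := particleCreation_toParticle q f n ((toPre q H n).symm F)
    refine (congrArg (inner ℂ _) h).trans ((inner_toParticle q (n + 1) _ _).trans ?_)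
    rw [inner_tensorPower_lam_tensorLeft, ← inner_toParticle]
    rfl

/-- The pairing is tested against arbitrary Fock vectors, so the span of the powers of `f` is seen
to be invariant under the adjoint as well. -/
theorem annihilation_fockPower_succ (f : H) (n : ℕ) :
    annihilation q f (fockPower q f (n + 1)) =
      (jacobiCoeff q ‖f‖ n : ℂ) • fockPower q f n := by
  refine ext_inner_right ℂ fun x => ?_
  rw [annihilation, ContinuousLinearMap.adjoint_inner_left, inner_smul_left, Complex.conj_ofReal,
    fockPower, fockPower, lp.inner_single_left, lp.inner_single_left, creation_apply_succ,
    inner_particleCreation]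

theorem annihilation_vacuum (f : H) : annihilation q f (fockPower q f 0) = 0 := by
  refine ext_inner_right ℂ fun x => ?_
  rw [annihilation, ContinuousLinearMap.adjoint_inner_left, fockPower, lp.inner_single_left,
    inner_zero_left]
  exact inner_zero_right _

theorem field_fockPower_zero (f : H) : field q f (fockPower q f 0) = fockPower q f 1 := by
  rw [field, add_apply, annihilation_vacuum, creation_fockPower, zero_add]

theorem field_fockPower_succ (f : H) (n : ℕ) :
    field q f (fockPower q f (n + 1)) =
      fockPower q f (n + 2) + (jacobiCoeff q ‖f‖ n : ℂ) • fockPower q f n := by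
  rw [field, add_apply, annihilation_fockPower_succ, creation_fockPower, add_comm]

theorem inner_vacuum_fockPower (f : H) (n : ℕ) :
    inner ℂ (vacuum q H) (fockPower q f n) = if n = 0 then 1 else 0 := by
  rw [vacuum, lp.inner_single_left, fockPower]
  split_ifs with h
  · subst h
    rw [lp.single_apply_self, inner_toParticle]
    change inner ℂ (1 : ℂ) (1 : ℂ) = (1 : ℂ)
    simp
  · rw [lp.single_apply_ne _ _ _ (Ne.symm h), inner_zero_right]

end FockVectors

/-! ### Monic Jacobi polynomials and the moment functional -/

section JacobiPolynomials

open Polynomial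

/-- The monic orthogonal polynomials with vanishing diagonal coefficients and off-diagonal
coefficients `ω`. -/
noncomputable def jacobiPoly (ω : ℕ → ℝ) : ℕ → ℝ[X]
  | 0 => 1
  | 1 => X
  | n + 2 => X * jacobiPoly ω (n + 1) - C (ω n) * jacobiPoly ω n

theorem jacobiPoly_add_two (ω : ℕ → ℝ) (n : ℕ) :
    jacobiPoly ω (n + 2) = X * jacobiPoly ω (n + 1) - C (ω n) * jacobiPoly ω n := rfl

/-- The recurrence, solved for `X * P_{n+1}`, shows that the span is stable under multiplication by
`X`; as it contains `1`, it contains all monomials. -/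
theorem span_jacobiPoly (ω : ℕ → ℝ) :
    Submodule.span ℝ (Set.range (jacobiPoly ω)) = ⊤ := by
  set S := Submodule.span ℝ (Set.range (jacobiPoly ω)) with hS
  have hmem : ∀ n, jacobiPoly ω n ∈ S := fun n => Submodule.subset_span ⟨n, rfl⟩
  have hX : ∀ p ∈ S, X * p ∈ S := by
    intro p hp
    induction hp using Submodule.span_induction with
    | mem p hp =>
      obtain ⟨n, rfl⟩ := hp
      match n with
      | 0 => simpa [jacobiPoly] using hmem 1
      | n + 1 =>
        have h : X * jacobiPoly ω (n + 1) = jacobiPoly ω (n + 2) + ω n • jacobiPoly ω n := by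
          rw [jacobiPoly_add_two, smul_eq_C_mul]; ring
        rw [h]
        exact S.add_mem (hmem _) (S.smul_mem _ (hmem _))
    | zero => simp
    | add a b _ _ ha hb => rw [mul_add]; exact S.add_mem ha hb
    | smul c a _ ha => rw [mul_smul_comm]; exact S.smul_mem _ ha
  have hpow : ∀ n : ℕ, (X : ℝ[X]) ^ n ∈ S := by
    intro n
    induction n with
    | zero => simpa [jacobiPoly] using hmem 0
    | succ n ih => rw [pow_succ']; exact hX _ ih
  refine Submodule.eq_top_iff'.2 fun p => ?_
  rw [p.as_sum_range_C_mul_X_pow]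
  refine S.sum_mem fun i _ => ?_
  rw [← smul_eq_C_mul]
  exact S.smul_mem _ (hpow i)

theorem linearMap_ext_jacobiPoly {M : Type*} [AddCommMonoid M] [Module ℝ M] (ω : ℕ → ℝ)
    {L L' : ℝ[X] →ₗ[ℝ] M} (h : ∀ n, L (jacobiPoly ω n) = L' (jacobiPoly ω n)) : L = L' :=
  LinearMap.ext_on_range (span_jacobiPoly ω) h

variable {H : Type u} [NormedAddCommGroup H] [InnerProductSpace ℂ H] (q : Set.Icc (-1 : ℝ) 1)

/-- The polynomials are defined by the very recurrence that the field operator obeys on the powers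
of `f`. -/
theorem aeval_field_jacobiPoly_vacuum (f : H) (n : ℕ) :
    aeval (field q f) (jacobiPoly (jacobiCoeff q ‖f‖) n) (vacuum q H) = fockPower q f n := by
  induction n using Nat.twoStepInduction with
  | zero => simp [jacobiPoly, fockPower_zero]
  | one => rw [jacobiPoly, aeval_X, ← fockPower_zero q f, field_fockPower_zero]
  | more n h0 h1 =>
    rw [jacobiPoly_add_two, map_sub, map_mul, aeval_X, ← smul_eq_C_mul, map_smul, sub_apply,
      mul_apply_eq_comp, h1, smul_apply, h0, field_fockPower_succ]
    exact add_sub_cancel_right _ _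

/-- The moment functional `p ↦ ⟨Φ, p(T) Φ⟩`. -/
noncomputable def momentFunctional {K : Type*} [NormedAddCommGroup K] [InnerProductSpace ℂ K]
    (T : K →L[ℂ] K) (Φ : K) : ℝ[X] →ₗ[ℝ] ℝ where
  toFun p := (inner ℂ Φ (aeval T p Φ)).re
  map_add' p r := by rw [map_add, add_apply, inner_add_right, Complex.add_re]
  map_smul' c p := by
    rw [map_smul, smul_apply, inner_smul_right_eq_smul]
    simp

theorem momentFunctional_field_jacobiPoly (f : H) (n : ℕ) :
    momentFunctional (field q f) (vacuum q H) (jacobiPoly (jacobiCoeff q ‖f‖) n) =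
      if n = 0 then 1 else 0 := by
  refine (congrArg (fun v => (inner ℂ (vacuum q H) v).re)
    (aeval_field_jacobiPoly_vacuum q f n)).trans ?_
  simp only [inner_vacuum_fockPower]
  split_ifs <;> simp

end JacobiPolynomials

/-! ### Determinacy of the moment problem for bounded support -/

section Determinacy

open Polynomial

theorem integrable_eval_polynomial {ν : Measure ℝ} [IsFiniteMeasure ν] {R : ℝ}
    (hν : ν (Set.Icc (-R) R)ᶜ = 0) (p : ℝ[X]) : Integrable (fun x => p.eval x) ν := by
  obtain ⟨C, hC⟩ := (isCompact_Icc (a := -R) (b := R)).exists_bound_of_continuousOn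
    p.continuous.continuousOn
  have h : ∀ᵐ x ∂ν, x ∈ Set.Icc (-R) R := hν
  refine Integrable.of_bound p.continuous.aestronglyMeasurable C ?_
  filter_upwards [h] with x hx using hC x hx

variable {K : Type*} [NormedAddCommGroup K] [InnerProductSpace ℂ K] [CompleteSpace K]

/-- A finite measure with bounded support is the distribution of `T` in the vector state of `Φ`
as soon as it has the same moments. -/
theorem distribution_eq_of_moments {T : K →L[ℂ] K} (hT : IsSelfAdjoint T) (Φ : K)
    (ν : Measure ℝ) [IsFiniteMeasure ν] {R : ℝ} (hν : ν (Set.Icc (-R) R)ᶜ = 0)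
    (hmom : ∀ p : ℝ[X], ∫ x, p.eval x ∂ν = momentFunctional T Φ p) :
    distribution T Φ = ν := by
  have : (distribution T Φ).Regular := RealRMK.regular_rieszMeasure _
  refine Measure.ext_of_integral_eq_on_compactlySupported fun g => ?_
  rw [integral_distribution]
  -- One interval has to contain both the support of `ν` and the spectrum of `T`, so that a single
  -- Weierstrass approximation serves both sides.
  set r : ℝ := max R ‖T‖ with hr
  have hsupp : ∀ᵐ x ∂ν, x ∈ Set.Icc (-r) r := by
    have h : ∀ᵐ x ∂ν, x ∈ Set.Icc (-R) R := hν
    filter_upwards [h] with x hx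
    exact ⟨(neg_le_neg (le_max_left _ _)).trans hx.1, hx.2.trans (le_max_left _ _)⟩
  have hspec : ∀ x ∈ spectrum ℝ T, x ∈ Set.Icc (-r) r := by
    intro x hx
    have h := spectrum.norm_le_norm_mul_of_mem hx
    -- Only an inequality, because `K` may be the zero space.
    have h1 : ‖(1 : K →L[ℂ] K)‖ ≤ 1 := ContinuousLinearMap.norm_id_le
    have h2 : |x| ≤ ‖T‖ := h.trans (mul_le_of_le_one_right (norm_nonneg _) h1)
    exact abs_le.1 (h2.trans (le_max_right _ _))
  have hgi : Integrable (fun x => g x) ν := g.continuous.integrable_of_hasCompactSupport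
    g.hasCompactSupport
  have hpi : ∀ p : ℝ[X], Integrable (fun x => p.eval x) ν := integrable_eval_polynomial hν
  have key : ∀ ε > 0, |(inner ℂ Φ (cfc (g : ℝ → ℝ) T Φ)).re - ∫ x, g x ∂ν| ≤
      ε * (‖Φ‖ * ‖Φ‖ + ν.real Set.univ) := by
    intro ε hε
    obtain ⟨p, hp⟩ := exists_polynomial_near_of_continuousOn (-r) r g g.continuous.continuousOn ε hε
    have h1 : |(inner ℂ Φ (cfc (g : ℝ → ℝ) T Φ)).re - momentFunctional T Φ p| ≤
        ε * (‖Φ‖ * ‖Φ‖) := by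
      have e : (inner ℂ Φ (cfc (g : ℝ → ℝ) T Φ)).re - momentFunctional T Φ p =
          (inner ℂ Φ (cfc (fun x => g x - p.eval x) T Φ)).re := by
        have e' : cfc (fun x => g x - p.eval x) T = cfc (g : ℝ → ℝ) T - aeval T p := by
          rw [cfc_sub g (fun x => p.eval x) T g.continuous.continuousOn p.continuous.continuousOn,
            cfc_polynomial p T hT]
        rw [e', sub_apply, inner_sub_right, Complex.sub_re]
        rfl
      rw [e]
      have hn : ‖cfc (fun x => g x - p.eval x) T‖ ≤ ε :=
        norm_cfc_le hε.le fun x hx => by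
          rw [Real.norm_eq_abs, abs_sub_comm]; exact (hp x (hspec x hx)).le
      calc _ ≤ ‖inner ℂ Φ (cfc (fun x => g x - p.eval x) T Φ)‖ := Complex.abs_re_le_norm _
        _ ≤ ‖Φ‖ * ‖cfc (fun x => g x - p.eval x) T Φ‖ := norm_inner_le_norm _ _
        _ ≤ ‖Φ‖ * (ε * ‖Φ‖) := by
          gcongr; exact (ContinuousLinearMap.le_opNorm _ _).trans (by gcongr)
        _ = ε * (‖Φ‖ * ‖Φ‖) := by ring
    have h2 : |momentFunctional T Φ p - ∫ x, g x ∂ν| ≤ ε * ν.real Set.univ := by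
      rw [← hmom, ← integral_sub (hpi p) hgi]
      refine norm_integral_le_of_norm_le_const (μ := ν) (f := fun x => p.eval x - g x) ?_
      filter_upwards [hsupp] with x hx using (hp x hx).le
    calc _ ≤ _ := abs_sub_le _ (momentFunctional T Φ p) _
      _ ≤ _ := by rw [mul_add]; exact add_le_add h1 h2
  set M : ℝ := ‖Φ‖ * ‖Φ‖ + ν.real Set.univ with hM
  have hM0 : 0 ≤ M := by positivity
  refine sub_eq_zero.1 (abs_nonpos_iff.1 (le_of_forall_pos_le_add fun δ hδ => ?_))
  -- The denominator is `M + 1` because `M` may vanish.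
  have h := key (δ / (M + 1)) (by positivity)
  have h' : δ / (M + 1) * M ≤ δ := by
    rw [div_mul_eq_mul_div, div_le_iff₀ (by positivity)]
    nlinarith
  linarith

end Determinacy

/-! ### Trigonometric integrals and their recurrence -/

section Trigonometry

open Real

/-- The denominator of the density of the law of `Q(f)` for `‖f‖ = 1`. -/
def denom (q x : ℝ) : ℝ := 1 + q * (q + 3) * x ^ 2 - q * x ^ 4

/-- The real part of `1 - q z⁻² - q z⁻⁴`, `z = exp (iθ)`. -/
noncomputable def cosFactor (q θ : ℝ) : ℝ := 1 - q * cos (2 * θ) - q * cos (4 * θ)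

/-- The imaginary part of `1 - q z⁻² - q z⁻⁴`, `z = exp (iθ)`. -/
noncomputable def sinFactor (q θ : ℝ) : ℝ := q * sin (2 * θ) + q * sin (4 * θ)

/-- The imaginary part of `zᵏ (1 - q z⁻² - q z⁻⁴)`, `z = exp (iθ)`. -/
noncomputable def sinCombination (q k θ : ℝ) : ℝ :=
  sin (k * θ) - q * sin ((k - 2) * θ) - q * sin ((k - 4) * θ)

theorem denom_two_mul_cos (q θ : ℝ) :
    denom q (2 * cos θ) = cosFactor q θ ^ 2 + sinFactor q θ ^ 2 := by
  have e : (4 : ℝ) * θ = 2 * (2 * θ) := by ring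
  have h := sin_sq_add_cos_sq (2 * θ)
  rw [denom, cosFactor, sinFactor, e, cos_two_mul (2 * θ), sin_two_mul (2 * θ)]
  have e1 : sin (2 * θ) ^ 2 = 1 - cos (2 * θ) ^ 2 := by linarith
  have e2 : (q * sin (2 * θ) + q * (2 * sin (2 * θ) * cos (2 * θ))) ^ 2 =
      q ^ 2 * sin (2 * θ) ^ 2 * (1 + 2 * cos (2 * θ)) ^ 2 := by ring
  rw [e2, e1, cos_two_mul]
  ring

theorem sinCombination_eq (q k θ : ℝ) :
    sinCombination q k θ = sin (k * θ) * cosFactor q θ + cos (k * θ) * sinFactor q θ := by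
  rw [sinCombination, sub_mul, sub_mul, sin_sub, sin_sub, cosFactor, sinFactor]
  ring

/-- With `h(z) = 1 - q z² - q z⁴`, the left side is the imaginary part of `zᵏ h(z⁻¹)` multiplied by
`h(z)`, and `h(z⁻¹) h(z) = |h(z)|²` is real on the unit circle. -/
theorem sinCombination_recurrence (q k θ : ℝ) :
    sinCombination q k θ - q * sinCombination q (k + 2) θ - q * sinCombination q (k + 4) θ =
      sin (k * θ) * denom q (2 * cos θ) := by
  rw [denom_two_mul_cos]
  simp only [sinCombination_eq, add_mul, sin_add, cos_add, cosFactor, sinFactor]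
  ring

theorem sinCombination_add_two (q k θ : ℝ) :
    sinCombination q (k + 2) θ =
      2 * cos θ * sinCombination q (k + 1) θ - sinCombination q k θ := by
  simp only [sinCombination_eq]
  have e1 : (k + 2) * θ = (k + 1) * θ + θ := by ring
  have e2 : k * θ = (k + 1) * θ - θ := by ring
  rw [e1, e2, sin_add, cos_add, sin_sub, cos_sub]
  ring

/-- At `q = 1/2` the denominator vanishes at `x = ±2`, so a positive lower bound is not available
for all `q`. For `q ≥ 0`, `4 D - (4 - x²) = 4 q x² (4 - x²) + (2q - 1)² x²`. For `q < 0`, completing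
the square in `x²` bounds `D` below by `(1 + q)² (4 + q) / 4`. -/
theorem exists_sub_sq_le_denom {q : ℝ} (hq : -1 < q) :
    ∃ C, 0 < C ∧ ∀ x, x ^ 2 ≤ 4 → 4 - x ^ 2 ≤ C * denom q x := by
  rcases le_or_gt 0 q with h0 | h0
  · refine ⟨4, by norm_num, fun x hx => ?_⟩
    rw [denom]
    nlinarith [mul_nonneg (mul_nonneg h0 (sq_nonneg x)) (sub_nonneg.2 hx),
      mul_nonneg (sq_nonneg x) (sq_nonneg (2 * q - 1))]
  · have hm : 0 < (1 + q) ^ 2 * (4 + q) := mul_pos (pow_pos (by linarith) 2) (by linarith)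
    refine ⟨16 / ((1 + q) ^ 2 * (4 + q)), by positivity, fun x _ => ?_⟩
    have h : (1 + q) ^ 2 * (4 + q) / 4 ≤ denom q x := by
      rw [denom]
      nlinarith [mul_nonneg (neg_nonneg.2 h0.le) (sq_nonneg (x ^ 2 - (3 + q) / 2))]
    calc 4 - x ^ 2 ≤ 4 := by linarith [sq_nonneg x]
      _ = 16 / ((1 + q) ^ 2 * (4 + q)) * ((1 + q) ^ 2 * (4 + q) / 4) := by
        rw [div_mul_div_comm, mul_comm (16 : ℝ), mul_div_mul_left _ _ hm.ne']; norm_num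
      _ ≤ _ := by gcongr

theorem denom_pos {q x : ℝ} (hq : -1 < q) (hx : x ^ 2 < 4) : 0 < denom q x := by
  obtain ⟨C, hC, h⟩ := exists_sub_sq_le_denom hq
  exact pos_of_mul_pos_right ((sub_pos.2 hx).trans_le (h x hx.le)) hC.le

theorem two_mul_cos_sq_lt {θ : ℝ} (hθ : θ ∈ Set.Ioo 0 π) : (2 * cos θ) ^ 2 < 4 := by
  nlinarith [sin_sq_add_cos_sq θ, pow_pos (sin_pos_of_mem_Ioo hθ) 2]

theorem exists_sin_sq_le_denom {q : ℝ} (hq : -1 < q) :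
    ∃ C, 0 < C ∧ ∀ θ, sin θ ^ 2 ≤ C * denom q (2 * cos θ) := by
  obtain ⟨C, hC, h⟩ := exists_sub_sq_le_denom hq
  refine ⟨C, hC, fun θ => ?_⟩
  have h1 := h (2 * cos θ) (by nlinarith [sin_sq_add_cos_sq θ, sq_nonneg (sin θ)])
  nlinarith [sin_sq_add_cos_sq θ, sq_nonneg (sin θ)]

/-- The integrand is bounded by `√C`: each of `sin θ` and `g θ` is at most a constant times the
square root of the denominator. This covers the singular value `q = 1/2`. -/
theorem integrableOn_sin_mul_div_denom {q : ℝ} (hq : -1 < q) {g : ℝ → ℝ} (hg : Continuous g)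
    (hle : ∀ θ, g θ ^ 2 ≤ denom q (2 * cos θ)) :
    IntegrableOn (fun θ => sin θ * g θ / denom q (2 * cos θ)) (Set.Ioo 0 π) := by
  obtain ⟨C, hC, h⟩ := exists_sin_sq_le_denom hq
  have hd : Continuous (denom q) := by unfold denom; fun_prop
  have hm : Measurable fun θ => sin θ * g θ / denom q (2 * cos θ) := by
    have := hg.measurable
    have := hd.measurable
    fun_prop
  refine IntegrableOn.of_bound (by simp) hm.aestronglyMeasurable (sqrt C) ?_
  refine (ae_restrict_iff' measurableSet_Ioo).2 (ae_of_all _ fun θ hθ => ?_)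
  have hD := denom_pos hq (two_mul_cos_sq_lt hθ)
  rw [norm_eq_abs]
  refine abs_le_sqrt ?_
  rw [div_pow, mul_pow, div_le_iff₀ (by positivity)]
  calc _ ≤ C * denom q (2 * cos θ) * denom q (2 * cos θ) := by
        gcongr
        · exact h θ
        · exact hle θ
    _ = _ := by ring

/-- The sequence `∫₀^π sin θ Im (zᵏ / h(z)) dθ`, where `h(z) = 1 - q z² - q z⁴`. -/
noncomputable def sinCoeff (q : ℝ) (k : ℤ) : ℝ :=
  ∫ θ in Set.Ioo 0 π, sin θ * sinCombination q k θ / denom q (2 * cos θ)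

theorem continuous_cosFactor (q : ℝ) : Continuous (cosFactor q) := by
  unfold cosFactor; fun_prop

theorem continuous_sinFactor (q : ℝ) : Continuous (sinFactor q) := by
  unfold sinFactor; fun_prop

theorem integrableOn_sinCombination {q : ℝ} (hq : -1 < q) (k : ℝ) :
    IntegrableOn (fun θ => sin θ * sinCombination q k θ / denom q (2 * cos θ))
      (Set.Ioo 0 π) := by
  refine integrableOn_sin_mul_div_denom hq (by unfold sinCombination; fun_prop) fun θ => ?_
  rw [sinCombination_eq, denom_two_mul_cos]
  -- Cauchy–Schwarz in the plane; the square supplied is its defect.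
  nlinarith [sin_sq_add_cos_sq (k * θ),
    sq_nonneg (cos (k * θ) * cosFactor q θ - sin (k * θ) * sinFactor q θ)]

/-- The numbers are imaginary parts of Fourier coefficients of the integrable function `sin θ /
h(z)` on `(0, π)`. The filter `cofinite` on `ℤ` records decay at both ends. -/
theorem tendsto_sinCoeff {q : ℝ} (hq : -1 < q) :
    Filter.Tendsto (sinCoeff q) Filter.cofinite (nhds 0) := by
  set G : ℝ → ℂ := fun θ => ((sin θ * cosFactor q θ / denom q (2 * cos θ) : ℝ) : ℂ) +
    ((sin θ * sinFactor q θ / denom q (2 * cos θ) : ℝ) : ℂ) * Complex.I with hG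
  have h1 := integrableOn_sin_mul_div_denom hq (continuous_cosFactor q) fun θ => by
    rw [denom_two_mul_cos]; nlinarith [sq_nonneg (sinFactor q θ)]
  have h2 := integrableOn_sin_mul_div_denom hq (continuous_sinFactor q) fun θ => by
    rw [denom_two_mul_cos]; nlinarith [sq_nonneg (cosFactor q θ)]
  have hGi : IntegrableOn G (Set.Ioo 0 π) := h1.ofReal.add (h2.ofReal.mul_const _)
  have hRL := Real.tendsto_integral_exp_smul_cocompact ((Set.Ioo 0 π).indicator G)
  have hc : (-(2 * π)⁻¹ : ℝ) ≠ 0 := neg_ne_zero.2 (by positivity)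
  -- The frequency `-k / (2π)` makes the Fourier kernel equal to `exp (i k θ)`.
  have hk : Filter.Tendsto (fun k : ℤ => (k : ℝ) * -(2 * π)⁻¹) Filter.cofinite
      (Filter.cocompact ℝ) :=
    (Homeomorph.mulRight₀ _ hc).isClosedEmbedding.tendsto_cocompact.comp Int.tendsto_coe_cofinite
  have h := (Complex.continuous_im.tendsto _).comp (hRL.comp hk)
  rw [Complex.zero_im] at h
  refine h.congr fun k => ?_
  have hexp : ∀ v : ℝ, (fourierChar (-(v * ((k : ℝ) * -(2 * π)⁻¹))) : ℂ) =
      (cos (k * v) : ℝ) + (sin (k * v) : ℝ) * Complex.I := by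
    intro v
    have e : 2 * π * -(v * ((k : ℝ) * -(2 * π)⁻¹)) = k * v := by
      field_simp
    rw [fourierChar_apply, e, Complex.exp_mul_I, Complex.ofReal_cos, Complex.ofReal_sin]
  have hint : Integrable (fun v => fourierChar (-(v * ((k : ℝ) * -(2 * π)⁻¹))) • G v)
      (volume.restrict (Set.Ioo 0 π)) :=
    Integrable.mono hGi ((Continuous.aestronglyMeasurable (by fun_prop)).smul
      hGi.aestronglyMeasurable) (ae_of_all _ fun v => (Circle.norm_smul _ _).le)
  simp only [Function.comp_apply]
  have e1 : ∀ v : ℝ, fourierChar (-(v * ((k : ℝ) * -(2 * π)⁻¹))) • (Set.Ioo 0 π).indicator G v =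
      (Set.Ioo 0 π).indicator
        (fun v => fourierChar (-(v * ((k : ℝ) * -(2 * π)⁻¹))) • G v) v := by
    intro v
    by_cases hv : v ∈ Set.Ioo 0 π <;> simp [hv]
  simp_rw [e1]
  rw [integral_indicator measurableSet_Ioo]
  refine (integral_im hint).symm.trans ?_
  rw [sinCoeff]
  congr 1 with v
  have him : ∀ a b c d : ℝ,
      RCLike.im (((a : ℂ) + b * Complex.I) • ((c : ℂ) + d * Complex.I)) = a * d + b * c := by
    intro a b c d
    simp
  rw [Circle.smul_def, hexp, hG, sinCombination_eq]
  refine (him _ _ _ _).trans ?_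
  ring

theorem integral_sin_mul_sin (k : ℤ) :
    ∫ θ in Set.Ioo 0 π, sin θ * sin (k * θ) =
      if k = 1 then π / 2 else if k = -1 then -(π / 2) else 0 := by
  have hcos : ∀ m : ℤ, ∫ θ in (0 : ℝ)..π, cos (m * θ) = if m = 0 then π else 0 := by
    intro m
    split_ifs with hm
    · simp [hm]
    · have hm' : (m : ℝ) ≠ 0 := by exact_mod_cast hm
      rw [intervalIntegral.integral_comp_mul_left _ hm', integral_cos, sin_int_mul_pi]
      simp
  have hprod : ∀ θ : ℝ, sin θ * sin (k * θ) =
      2⁻¹ * (cos (((k - 1 : ℤ) : ℝ) * θ) - cos (((k + 1 : ℤ) : ℝ) * θ)) := by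
    intro θ
    push_cast
    rw [sub_mul, add_mul, one_mul, cos_sub, cos_add]
    ring
  rw [← integral_Ioc_eq_integral_Ioo, ← intervalIntegral.integral_of_le pi_pos.le]
  simp_rw [hprod]
  rw [intervalIntegral.integral_const_mul, intervalIntegral.integral_sub
    (Continuous.intervalIntegrable (by fun_prop) _ _)
    (Continuous.intervalIntegrable (by fun_prop) _ _), hcos, hcos]
  by_cases h1 : k = 1
  · subst h1; norm_num; ring
  · by_cases h2 : k = -1
    · subst h2; norm_num; ring
    · rw [if_neg (by omega), if_neg (by omega), if_neg h1, if_neg h2]; simp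

theorem sinCoeff_recurrence {q : ℝ} (hq : -1 < q) (k : ℤ) :
    sinCoeff q k - q * sinCoeff q (k + 2) - q * sinCoeff q (k + 4) =
      if k = 1 then π / 2 else if k = -1 then -(π / 2) else 0 := by
  rw [← integral_sin_mul_sin, sinCoeff, sinCoeff, sinCoeff, ← integral_const_mul,
    ← integral_const_mul, ← integral_sub, ← integral_sub]
  · refine setIntegral_congr_fun measurableSet_Ioo fun θ hθ => ?_
    have hD := (denom_pos hq (two_mul_cos_sq_lt hθ)).ne'
    have h := sinCombination_recurrence q k θ
    push_cast
    field_simp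
    linear_combination sin θ * h
  · exact (integrableOn_sinCombination hq _).sub ((integrableOn_sinCombination hq _).const_mul _)
  · exact (integrableOn_sinCombination hq _).const_mul _
  · exact integrableOn_sinCombination hq _
  · exact (integrableOn_sinCombination hq _).const_mul _

end Trigonometry

/-! ### Decaying solutions of the recurrence -/

section Recurrence

open Filter

theorem eq_zero_of_norm_le_norm_succ {E : Type*} [NormedAddCommGroup E] {x : ℕ → E}
    (hx : Tendsto x atTop (nhds 0)) (h : ∀ n, ‖x n‖ ≤ ‖x (n + 1)‖) : x 0 = 0 := by
  have hm : Monotone fun n => ‖x n‖ := monotone_nat_of_le_succ h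
  have := hm.ge_of_tendsto (by simpa using hx.norm) 0
  exact norm_le_zero_iff.1 this

/-- A two-sided sequence satisfying a first order recurrence with step `2` on a half line
unbounded above vanishes there if it decays. -/
theorem eq_zero_of_eq_mul_add_two {x : ℤ → ℂ} (hx : Tendsto x cofinite (nhds 0)) {β : ℂ}
    (hβ : ‖β‖ ≤ 1) {k₀ : ℤ} (h : ∀ k, k₀ ≤ k → x k = β * x (k + 2)) {k : ℤ} (hk : k₀ ≤ k) :
    x k = 0 := by
  have hinj : Function.Injective fun n : ℕ => k + 2 * (n : ℤ) := fun a b hab => by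
    simp only at hab; omega
  have hlim := hx.comp (Nat.cofinite_eq_atTop ▸ hinj.tendsto_cofinite)
  have := eq_zero_of_norm_le_norm_succ hlim fun n => by
    simp only [Function.comp_apply]
    rw [h (k + 2 * n) (by omega), norm_mul]
    refine (mul_le_of_le_one_left (norm_nonneg _) hβ).trans (le_of_eq ?_)
    congr 2
    push_cast
    ring
  simpa using this

/-- For `q ≥ 0` the roots of `X² - q X - q` are real, and the larger is at most `1` because `√(q² +
4q) ≤ 2 - q` amounts to `q ≤ 1/2`. For `q < 0` they are conjugate, of squared modulus `-q`. -/
theorem exists_factorization {q : ℝ} (hq : -1 < q) (hq' : q ≤ 1 / 2) :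
    ∃ α β : ℂ, α + β = q ∧ α * β = -q ∧ ‖α‖ ≤ 1 ∧ ‖β‖ ≤ 1 := by
  rcases le_or_gt 0 q with h0 | h0
  · set R := Real.sqrt (q ^ 2 + 4 * q) with hR
    have hR0 : 0 ≤ R := Real.sqrt_nonneg _
    have hR2 : R ^ 2 = q ^ 2 + 4 * q := Real.sq_sqrt (by positivity)
    have hRle : R ≤ 2 - q := by
      rw [hR, Real.sqrt_le_left (by linarith)]
      nlinarith
    have hqR : q ≤ R := by nlinarith
    refine ⟨((q + R) / 2 : ℝ), ((q - R) / 2 : ℝ), ?_, ?_, ?_, ?_⟩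
    · rw [← Complex.ofReal_add]; congr 1; ring
    · rw [← Complex.ofReal_mul, ← Complex.ofReal_neg]; congr 1; nlinarith
    · rw [Complex.norm_real, Real.norm_eq_abs, abs_le]; constructor <;> linarith
    · rw [Complex.norm_real, Real.norm_eq_abs, abs_le]; constructor <;> linarith
  · set R := Real.sqrt (-(q ^ 2 + 4 * q)) with hR
    have hR2 : R ^ 2 = -(q ^ 2 + 4 * q) := Real.sq_sqrt (by nlinarith)
    refine ⟨⟨q / 2, R / 2⟩, ⟨q / 2, -(R / 2)⟩, ?_, ?_, ?_, ?_⟩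
    · apply Complex.ext <;> simp
    · apply Complex.ext
      · simp; nlinarith
      · simp; ring
    · rw [← sq_le_one_iff₀ (norm_nonneg _), ← Complex.normSq_eq_norm_sq, Complex.normSq_mk]
      nlinarith
    · rw [← sq_le_one_iff₀ (norm_nonneg _), ← Complex.normSq_eq_norm_sq, Complex.normSq_mk]
      nlinarith

/-- With `S` the shift by two, the homogeneous recurrence reads `(1 - βS)(1 - αS) c = 0` for `k ≥
2`. Decay removes one factor at a time, so a double root needs no separate treatment. -/
theorem sinCoeff_eq_zero {q : ℝ} (hq : -1 < q) (hq' : q ≤ 1 / 2) {k : ℤ} (hk : 2 ≤ k) :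
    sinCoeff q k = 0 := by
  obtain ⟨α, β, hs, hp, hα, hβ⟩ := exists_factorization hq hq'
  have hlim : Tendsto (fun k => (sinCoeff q k : ℂ)) cofinite (nhds 0) :=
    (Complex.continuous_ofReal.tendsto' 0 0 Complex.ofReal_zero).comp (tendsto_sinCoeff hq)
  have hrec : ∀ k : ℤ, 2 ≤ k → (sinCoeff q k : ℂ) - q * sinCoeff q (k + 2)
      - q * sinCoeff q (k + 4) = 0 := by
    intro k hk
    have := sinCoeff_recurrence hq k
    rw [if_neg (by omega), if_neg (by omega)] at this
    exact_mod_cast this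
  have hinj : Function.Injective fun k : ℤ => k + 2 := add_left_injective 2
  have hu : Tendsto (fun k => (sinCoeff q k : ℂ) - α * sinCoeff q (k + 2)) cofinite (nhds 0) := by
    simpa using hlim.sub ((hlim.comp hinj.tendsto_cofinite).const_mul α)
  have h1 : ∀ k : ℤ, 2 ≤ k → (sinCoeff q k : ℂ) = α * sinCoeff q (k + 2) := by
    intro k hk
    refine sub_eq_zero.1 (eq_zero_of_eq_mul_add_two hu hβ (k₀ := 2) (fun k hk => ?_) hk)
    have h := hrec k hk
    rw [show k + 2 + 2 = k + 4 by ring]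
    linear_combination h - (sinCoeff q (k + 2) : ℂ) * hs + (sinCoeff q (k + 4) : ℂ) * hp
  exact_mod_cast eq_zero_of_eq_mul_add_two hlim hα h1 hk

/-- The root of `X² - q X - q` that exceeds `1` when `q > 1/2`. -/
noncomputable def alphaRoot (q : ℝ) : ℝ := (q + Real.sqrt (q * (q + 4))) / 2

theorem alphaRoot_sq {q : ℝ} (hq : 0 ≤ q) : alphaRoot q ^ 2 = q * alphaRoot q + q := by
  have h : Real.sqrt (q * (q + 4)) ^ 2 = q * (q + 4) := Real.sq_sqrt (by positivity)
  rw [alphaRoot]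
  nlinarith

theorem one_lt_alphaRoot {q : ℝ} (hq : 1 / 2 < q) : 1 < alphaRoot q := by
  have h : 2 - q < Real.sqrt (q * (q + 4)) := Real.lt_sqrt_of_sq_lt (by nlinarith)
  rw [alphaRoot]
  linarith

/-- The decaying two-sided solution of the recurrence of `sinCoeff` for `q > 1/2`. -/
theorem sinCoeff_of_half_lt {q : ℝ} (hq : 1 / 2 < q) :
    (∀ k : ℤ, 2 ≤ k → sinCoeff q k = alphaRoot q * sinCoeff q (k + 2)) ∧
    sinCoeff q 2 = 0 ∧
    sinCoeff q 1 - alphaRoot q * sinCoeff q 3 = Real.pi / 2 ∧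
    alphaRoot q * (2 * alphaRoot q - q) * sinCoeff q 3 = Real.pi / 2 * (1 - alphaRoot q) := by
  have hq1 : -1 < q := by linarith
  set α := alphaRoot q with hαdef
  have hα1 : 1 < α := one_lt_alphaRoot hq
  have hα2 : α ^ 2 = q * α + q := alphaRoot_sq (by linarith)
  set c := sinCoeff q with hc
  have hlim : Tendsto (fun k => (c k : ℂ)) cofinite (nhds 0) :=
    (Complex.continuous_ofReal.tendsto' 0 0 Complex.ofReal_zero).comp (tendsto_sinCoeff hq1)
  have hrec : ∀ k : ℤ, c k - q * c (k + 2) - q * c (k + 4) =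
      if k = 1 then Real.pi / 2 else if k = -1 then -(Real.pi / 2) else 0 :=
    sinCoeff_recurrence hq1
  have hinj : Function.Injective fun k : ℤ => k + 2 := add_left_injective 2
  have hcomb : ∀ γ : ℝ,
      Tendsto (fun k => ((c k - γ * c (k + 2) : ℝ) : ℂ)) cofinite (nhds 0) := by
    intro γ
    simpa using hlim.sub ((hlim.comp hinj.tendsto_cofinite).const_mul (γ : ℂ))
  have hβ : ‖((q - α : ℝ) : ℂ)‖ ≤ 1 := by
    rw [Complex.norm_real, Real.norm_eq_abs, abs_le]
    constructor <;> nlinarith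
  -- To the right only the factor `1 - βS`, with `β = q - α`, can be removed, as `α > 1`.
  have hu : ∀ k : ℤ, 2 ≤ k → c k = α * c (k + 2) := by
    intro k hk
    have := eq_zero_of_eq_mul_add_two (hcomb α) hβ (k₀ := 2) (fun k hk => by
      have h := hrec k
      rw [if_neg (by omega), if_neg (by omega)] at h
      rw [show k + 2 + 2 = k + 4 by ring, ← Complex.ofReal_mul]
      congr 1
      linear_combination h - c (k + 4) * hα2) hk
    exact sub_eq_zero.1 (by exact_mod_cast this)
  -- To the left it is the factor `1 - αS` that goes: read backwards it contracts by `α⁻¹`. The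
  -- reflected sequence lets the same lemma apply.
  have hg : ∀ k : ℤ, k ≤ 0 → c k = (q - α) * c (k + 2) := by
    intro k hk
    have hlim' := (hcomb (q - α)).comp (neg_injective.tendsto_cofinite)
    have hα' : ‖((α⁻¹ : ℝ) : ℂ)‖ ≤ 1 := by
      rw [Complex.norm_real, Real.norm_eq_abs, abs_of_pos (by positivity)]
      exact inv_le_one_of_one_le₀ hα1.le
    have := eq_zero_of_eq_mul_add_two hlim' hα' (k₀ := 0) (fun j hj => by
      have h := hrec (-(j + 2))
      rw [if_neg (by omega), if_neg (by omega)] at h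
      simp only [Function.comp_apply]
      rw [← Complex.ofReal_mul]
      congr 1
      rw [eq_inv_mul_iff_mul_eq₀ (by positivity)]
      rw [show -(j + 2) + 2 = -j by ring, show -(j + 2) + 4 = -j + 2 by ring] at h
      rw [show -(j + 2) + 2 = -j by ring]
      linear_combination -h + c (-j + 2) * hα2) (k := -k) (by omega)
    simp only [Function.comp_apply, neg_neg] at this
    exact sub_eq_zero.1 (by exact_mod_cast this)
  -- The recurrence at `0` and `±1` glues the two half-line solutions and fixes the constants.
  have h0 := hrec 0
  have h1 := hrec 1
  have hm := hrec (-1)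
  have hg0 := hg 0 le_rfl
  have hgm := hg (-1) (by norm_num)
  have hu2 := hu 2 le_rfl
  have hu3 := hu 3 (by norm_num)
  norm_num at h0 h1 hm hg0 hgm hu2 hu3
  refine ⟨hu, ?_, ?_, ?_⟩
  · have h : (2 * α - q) * c 2 = 0 := by
      linear_combination hg0 - h0 - (q - α) * hu2 + c 4 * hα2
    exact (mul_eq_zero.1 h).resolve_left (by nlinarith)
  · linear_combination h1 + (q - α) * hu3 - c 5 * hα2
  · have e1 : c 1 - α * c 3 = Real.pi / 2 := by
      linear_combination h1 + (q - α) * hu3 - c 5 * hα2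
    linear_combination hgm - hm + c 3 * hα2 + (-α) * e1

end Recurrence

/-! ### The density under the substitution `x = 2 s cos θ` -/

section Density

open Real Polynomial

theorem scaled_denom {q s x : ℝ} (hs : s ≠ 0) :
    s ^ 4 + q * (q + 3) * s ^ 2 * x ^ 2 - q * x ^ 4 = s ^ 4 * denom q (x / s) := by
  rw [denom]
  field_simp

theorem div_sq_lt_four {s x : ℝ} (hs : 0 < s) (hx : x ∈ Set.Ioo (-2 * s) (2 * s)) :
    (x / s) ^ 2 < 4 := by
  rw [div_pow, div_lt_iff₀ (by positivity)]
  nlinarith [hx.1, hx.2]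

theorem measurable_density (q s : ℝ) : Measurable (density q s) := by
  unfold density
  refine Measurable.indicator ?_ measurableSet_Ioo
  fun_prop

theorem density_nonneg {q s : ℝ} (hq : -1 < q) (hs : 0 < s) (x : ℝ) : 0 ≤ density q s x := by
  refine Set.indicator_nonneg (fun x hx => ?_) x
  rw [scaled_denom hs.ne']
  have := denom_pos hq (div_sq_lt_four hs hx)
  have : 0 < 1 + q := by linarith
  positivity

theorem image_two_mul_cos {s : ℝ} (hs : 0 < s) :
    (fun θ => 2 * s * cos θ) '' Set.Ioo 0 π = Set.Ioo (-2 * s) (2 * s) := by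
  ext x
  constructor
  · rintro ⟨θ, hθ, rfl⟩
    have h := mapsTo_cos_Ioo hθ
    constructor <;> nlinarith [h.1, h.2]
  · intro hx
    have h1 : -1 < x / (2 * s) := by rw [lt_div_iff₀ (by positivity)]; linarith [hx.1]
    have h2 : x / (2 * s) < 1 := by rw [div_lt_one (by positivity)]; exact hx.2
    refine ⟨arccos (x / (2 * s)), ⟨arccos_pos.2 h2, ?_⟩, ?_⟩
    · exact lt_of_le_of_ne (arccos_le_pi _) fun h => by
        rw [arccos_eq_pi] at h; linarith
    · simp only
      rw [cos_arccos h1.le h2.le]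
      field_simp

theorem density_two_mul_cos {q s θ : ℝ} (hs : 0 < s) (hθ : θ ∈ Set.Ioo 0 π) :
    2 * s * sin θ * density q s (2 * s * cos θ) =
      2 * (1 + q) / π * (sin θ * sin θ / denom q (2 * cos θ)) := by
  have hx : 2 * s * cos θ ∈ Set.Ioo (-2 * s) (2 * s) :=
    image_two_mul_cos hs ▸ Set.mem_image_of_mem _ hθ
  have hsin := sin_pos_of_mem_Ioo hθ
  have hsqrt : sqrt (4 * s ^ 2 - (2 * s * cos θ) ^ 2) = 2 * s * sin θ := by
    rw [← sqrt_sq (by positivity : 0 ≤ 2 * s * sin θ)]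
    congr 1
    linear_combination -4 * s ^ 2 * sin_sq_add_cos_sq θ
  have hdiv : 2 * s * cos θ / s = 2 * cos θ := by field_simp
  rw [density, Set.indicator_of_mem hx, scaled_denom hs.ne', hsqrt, hdiv]
  rcases eq_or_ne (denom q (2 * cos θ)) 0 with h | h
  · simp [h]
  · field_simp

theorem hasDerivWithinAt_two_mul_cos (s θ : ℝ) (S : Set ℝ) :
    HasDerivWithinAt (fun θ => 2 * s * cos θ) (-(2 * s * sin θ)) S θ := by
  simpa using ((hasDerivAt_cos θ).const_mul (2 * s)).hasDerivWithinAt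

theorem injOn_two_mul_cos {s : ℝ} (hs : 0 < s) :
    Set.InjOn (fun θ => 2 * s * cos θ) (Set.Ioo 0 π) := fun x hx y hy h =>
  injOn_cos (Set.Ioo_subset_Icc_self hx) (Set.Ioo_subset_Icc_self hy)
    (mul_left_cancel₀ (by positivity : 2 * s ≠ 0) h)

theorem integrand_two_mul_cos {q s θ : ℝ} (hs : 0 < s) (hθ : θ ∈ Set.Ioo 0 π) (g : ℝ → ℝ) :
    |-(2 * s * sin θ)| • (density q s (2 * s * cos θ) * g (2 * s * cos θ)) =
      2 * (1 + q) / π * (sin θ * (sin θ * g (2 * s * cos θ)) / denom q (2 * cos θ)) := by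
  have hsin := sin_pos_of_mem_Ioo hθ
  rw [abs_neg, abs_of_pos (by positivity), smul_eq_mul, ← mul_assoc, density_two_mul_cos hs hθ]
  ring

theorem density_mul_eq_indicator (q s : ℝ) (g : ℝ → ℝ) :
    (fun x => density q s x * g x) =
      (Set.Ioo (-2 * s) (2 * s)).indicator fun x => density q s x * g x := by
  ext x
  by_cases hx : x ∈ Set.Ioo (-2 * s) (2 * s)
  · rw [Set.indicator_of_mem hx]
  · rw [Set.indicator_of_notMem hx, density, Set.indicator_of_notMem hx, zero_mul]

theorem integral_density_mul {q s : ℝ} (hs : 0 < s) (g : ℝ → ℝ) :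
    ∫ x, density q s x * g x =
      2 * (1 + q) / π *
        ∫ θ in Set.Ioo 0 π, sin θ * (sin θ * g (2 * s * cos θ)) / denom q (2 * cos θ) := by
  rw [density_mul_eq_indicator, integral_indicator measurableSet_Ioo, ← image_two_mul_cos hs,
    integral_image_eq_integral_abs_deriv_smul measurableSet_Ioo
      (fun θ _ => hasDerivWithinAt_two_mul_cos s θ _) (injOn_two_mul_cos hs),
    ← integral_const_mul]
  exact setIntegral_congr_fun measurableSet_Ioo fun θ hθ => integrand_two_mul_cos hs hθ g

theorem integrable_density {q s : ℝ} (hq : -1 < q) (hs : 0 < s) : Integrable (density q s) := by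
  have h : density q s = fun x => density q s x * (fun _ => (1 : ℝ)) x := by simp
  rw [h, density_mul_eq_indicator, integrable_indicator_iff measurableSet_Ioo,
    ← image_two_mul_cos hs, integrableOn_image_iff_integrableOn_abs_deriv_smul measurableSet_Ioo
      (fun θ _ => hasDerivWithinAt_two_mul_cos s θ _) (injOn_two_mul_cos hs)]
  refine IntegrableOn.congr_fun ?_
    (fun θ hθ => (integrand_two_mul_cos hs hθ fun _ => 1).symm) measurableSet_Ioo
  obtain ⟨C, hC, hle⟩ := exists_sin_sq_le_denom hq
  have hC' : sqrt C ≠ 0 := (sqrt_pos.2 hC).ne'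
  -- Division by `√C` normalises `sin θ` so that its square is at most the denominator.
  have hi := integrableOn_sin_mul_div_denom hq (g := fun θ => sin θ / sqrt C) (by fun_prop)
    fun θ => by
      rw [div_pow, sq_sqrt hC.le, div_le_iff₀ hC, mul_comm]
      exact hle θ
  refine IntegrableOn.congr_fun (hi.const_mul (2 * (1 + q) / π * sqrt C)) (fun θ _ => ?_)
    measurableSet_Ioo
  field_simp

/-- The measure with density `l_{q,f}`, `s = ‖f‖`. -/
noncomputable def densityMeasure (q s : ℝ) : Measure ℝ :=
  volume.withDensity fun x => ENNReal.ofReal (density q s x)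

theorem isFiniteMeasure_densityMeasure {q s : ℝ} (hq : -1 < q) (hs : 0 < s) :
    IsFiniteMeasure (densityMeasure q s) :=
  isFiniteMeasure_withDensity_ofReal (integrable_density hq hs).hasFiniteIntegral

theorem densityMeasure_compl_Icc (q s : ℝ) :
    densityMeasure q s (Set.Icc (-(2 * s)) (2 * s))ᶜ = 0 := by
  rw [densityMeasure, withDensity_apply _ measurableSet_Icc.compl]
  refine (setLIntegral_congr_fun measurableSet_Icc.compl fun x hx => ?_).trans lintegral_zero
  have hx' : x ∉ Set.Ioo (-2 * s) (2 * s) := fun h => hx ⟨by linarith [h.1], h.2.le⟩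
  rw [density, Set.indicator_of_notMem hx', ENNReal.ofReal_zero]

theorem integral_densityMeasure {q s : ℝ} (hq : -1 < q) (hs : 0 < s) (g : ℝ → ℝ) :
    ∫ x, g x ∂densityMeasure q s = ∫ x, density q s x * g x := by
  rw [densityMeasure, integral_withDensity_eq_integral_toReal_smul
    (measurable_density q s).ennreal_ofReal (ae_of_all _ fun _ => ENNReal.ofReal_lt_top)]
  simp_rw [ENNReal.toReal_ofReal (density_nonneg hq hs _), smul_eq_mul]

/-- From degree two on the coefficients are constant, so both sides obey the same Chebyshev
recurrence; the exceptional `ω_1` enters only through the initial values. In degrees `0` and `1`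
this formula is not available, hence the separate integrals of `1` and `x`. -/
theorem jacobiPoly_eval_mul_sin (q s θ : ℝ) (n : ℕ) :
    sin θ * (jacobiPoly (jacobiCoeff q s) (n + 2)).eval (2 * s * cos θ) =
      s ^ (n + 2) * sinCombination q (n + 3 : ℕ) θ := by
  induction n using Nat.twoStepInduction with
  | zero =>
    have e1 : ((((0 + 3 : ℕ) : ℝ) - 2) * θ) = θ := by push_cast; ring
    have e2 : ((((0 + 3 : ℕ) : ℝ) - 4) * θ) = -θ := by push_cast; ring
    have e3 : (((0 + 3 : ℕ) : ℝ) * θ) = 3 * θ := by push_cast; ring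
    rw [sinCombination, e1, e2, e3, sin_neg, sin_three_mul]
    simp [jacobiPoly, jacobiCoeff]
    linear_combination 4 * s ^ 2 * sin θ * sin_sq_add_cos_sq θ
  | one =>
    have e1 : ((((1 + 3 : ℕ) : ℝ) - 2) * θ) = 2 * θ := by push_cast; ring
    have e2 : ((((1 + 3 : ℕ) : ℝ) - 4) * θ) = 0 := by push_cast; ring
    have e3 : (((1 + 3 : ℕ) : ℝ) * θ) = 2 * (2 * θ) := by push_cast; ring
    rw [sinCombination, e1, e2, e3, sin_zero, sin_two_mul (2 * θ), cos_two_mul, sin_two_mul]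
    simp [jacobiPoly, jacobiCoeff]
    ring
  | more n h0 h1 =>
    have e : ((n + 2 + 3 : ℕ) : ℝ) = ((n + 3 : ℕ) : ℝ) + 2 := by push_cast; ring
    have e' : ((n + 1 + 3 : ℕ) : ℝ) = ((n + 3 : ℕ) : ℝ) + 1 := by push_cast; ring
    rw [jacobiPoly_add_two, e, sinCombination_add_two]
    rw [e'] at h1
    simp only [eval_sub, eval_mul, eval_X, eval_C, jacobiCoeff]
    linear_combination (2 * s * cos θ) * h1 - s ^ 2 * h0

theorem integral_densityMeasure_jacobiPoly {q s : ℝ} (hq : -1 < q) (hs : 0 < s) (n : ℕ) :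
    ∫ x, (jacobiPoly (jacobiCoeff q s) (n + 2)).eval x ∂densityMeasure q s =
      2 * (1 + q) / π * s ^ (n + 2) * sinCoeff q (n + 3 : ℕ) := by
  rw [integral_densityMeasure hq hs, integral_density_mul hs, mul_assoc, sinCoeff,
    ← integral_const_mul (s ^ (n + 2))]
  congr 1
  refine integral_congr_ae (ae_of_all _ fun θ => ?_)
  simp only
  rw [jacobiPoly_eval_mul_sin, Int.cast_natCast]
  ring

theorem integral_densityMeasure_one {q s : ℝ} (hq : -1 < q) (hs : 0 < s) :
    ∫ _, (1 : ℝ) ∂densityMeasure q s = 2 / π * (sinCoeff q 1 - q * sinCoeff q 3) := by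
  rw [integral_densityMeasure hq hs, integral_density_mul hs, sinCoeff, sinCoeff,
    ← integral_const_mul q, ← integral_sub (integrableOn_sinCombination hq _)
      ((integrableOn_sinCombination hq _).const_mul _), ← integral_const_mul,
    ← integral_const_mul]
  refine integral_congr_ae (ae_of_all _ fun θ => ?_)
  have h : sinCombination q 1 θ - q * sinCombination q 3 θ = (1 + q) * sin θ := by
    have e1 : ((1 : ℝ) - 2) * θ = -θ := by ring
    have e2 : ((1 : ℝ) - 4) * θ = -(3 * θ) := by ring
    have e3 : ((3 : ℝ) - 2) * θ = θ := by ring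
    have e4 : ((3 : ℝ) - 4) * θ = -θ := by ring
    simp only [sinCombination, e1, e2, e3, e4, one_mul, sin_neg]
    ring
  push_cast
  linear_combination (-(2 / π * sin θ / denom q (2 * cos θ))) * h

theorem integral_densityMeasure_id {q s : ℝ} (hq : -1 < q) (hs : 0 < s) :
    ∫ x, x ∂densityMeasure q s = 2 / π * s * sinCoeff q 2 := by
  rw [integral_densityMeasure hq hs, integral_density_mul hs, sinCoeff, ← integral_const_mul,
    ← integral_const_mul]
  refine integral_congr_ae (ae_of_all _ fun θ => ?_)
  have h : sinCombination q 2 θ = (1 + q) * (2 * sin θ * cos θ) := by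
    have e1 : ((2 : ℝ) - 2) * θ = 0 := by ring
    have e2 : ((2 : ℝ) - 4) * θ = -(2 * θ) := by ring
    simp only [sinCombination, e1, e2, sin_zero, sin_neg, sin_two_mul]
    ring
  push_cast
  linear_combination (-(2 / π * s * sin θ / denom q (2 * cos θ))) * h

end Density

/-! ### Identification of the law; the case `q ≤ 1/2` -/

section FieldLaw

open Polynomial

variable {H : Type u} [NormedAddCommGroup H] [InnerProductSpace ℂ H] (q : Set.Icc (-1 : ℝ) 1)

/-- A finite measure of bounded support for which the Jacobi polynomials of the field operator
have the right integrals is the law of the field operator. -/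
theorem fieldLaw_eq_of_jacobiPoly (f : H) (ν : Measure ℝ) [IsFiniteMeasure ν] {R : ℝ}
    (hν : ν (Set.Icc (-R) R)ᶜ = 0) (h0 : ∫ _, (1 : ℝ) ∂ν = 1) (h1 : ∫ x, x ∂ν = 0)
    (h2 : ∀ n, ∫ x, (jacobiPoly (jacobiCoeff q ‖f‖) (n + 2)).eval x ∂ν = 0) :
    fieldLaw q f = ν := by
  refine distribution_eq_of_moments (isSelfAdjoint_field q f) _ ν hν fun p => ?_
  let L : ℝ[X] →ₗ[ℝ] ℝ :=
    { toFun := fun p => ∫ x, p.eval x ∂ν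
      map_add' := fun a b => by
        simp_rw [eval_add]
        exact integral_add (integrable_eval_polynomial hν a) (integrable_eval_polynomial hν b)
      map_smul' := fun c a => by
        simp_rw [eval_smul, smul_eq_mul]
        exact integral_const_mul _ _ }
  refine LinearMap.congr_fun (f := L) (linearMap_ext_jacobiPoly (jacobiCoeff q ‖f‖) fun n => ?_) p
  rw [momentFunctional_field_jacobiPoly]
  match n with
  | 0 => simpa [L, jacobiPoly] using h0
  | 1 => simpa [L, jacobiPoly] using h1
  | n + 2 => simpa [L] using h2 n

theorem integral_densityMeasure_of_le_half {q s : ℝ} (hq : -1 < q) (hq' : q ≤ 1 / 2)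
    (hs : 0 < s) : ∫ _, (1 : ℝ) ∂densityMeasure q s = 1 := by
  have h := sinCoeff_recurrence hq 1
  rw [sinCoeff_eq_zero hq hq' (k := 1 + 2) (by norm_num),
    sinCoeff_eq_zero hq hq' (k := 1 + 4) (by norm_num), if_pos rfl] at h
  rw [integral_densityMeasure_one hq hs, sinCoeff_eq_zero hq hq' (k := 3) (by norm_num)]
  have := Real.pi_ne_zero
  field_simp
  linarith

theorem fieldLaw_eq_densityMeasure (hq : -1 < (q : ℝ)) (hq' : (q : ℝ) ≤ 1 / 2) {f : H}
    (hf : f ≠ 0) : fieldLaw q f = densityMeasure q ‖f‖ := by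
  have hs : 0 < ‖f‖ := norm_pos_iff.2 hf
  have := isFiniteMeasure_densityMeasure hq hs
  have hz : ∀ k : ℤ, 2 ≤ k → sinCoeff q k = 0 := fun k => sinCoeff_eq_zero hq hq'
  refine fieldLaw_eq_of_jacobiPoly q f _ (densityMeasure_compl_Icc q ‖f‖) ?_ ?_ fun n => ?_
  · exact integral_densityMeasure_of_le_half hq hq' hs
  · rw [integral_densityMeasure_id hq hs, hz 2 le_rfl, mul_zero]
  · rw [integral_densityMeasure_jacobiPoly hq hs, hz _ (by omega), mul_zero]

end FieldLaw

/-! ### The two atoms for `q > 1/2` -/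

section Atoms

open Polynomial Real

theorem eval_neg_jacobiPoly (ω : ℕ → ℝ) (n : ℕ) (x : ℝ) :
    (jacobiPoly ω n).eval (-x) = (-1) ^ n * (jacobiPoly ω n).eval x := by
  induction n using Nat.twoStepInduction with
  | zero => simp [jacobiPoly]
  | one => simp [jacobiPoly]
  | more n h0 h1 =>
    simp only [jacobiPoly_add_two, eval_sub, eval_mul, eval_X, eval_C, h0, h1]
    ring

/-- The mass of each of the two atoms. -/
noncomputable def atomMass (q : ℝ) : ℝ := 1 / 2 * (1 - (1 + q) / sqrt (q * (q + 4)))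

/-- The location of the positive atom. -/
noncomputable def atomPoint (q s : ℝ) : ℝ := 2 * s * sqrt (aOne (1 + q))

theorem sqrt_eq_alphaRoot (q : ℝ) : sqrt (q * (q + 4)) = 2 * alphaRoot q - q := by
  rw [alphaRoot]; ring

theorem q_eq_alphaRoot {q : ℝ} (hq : 1 / 2 < q) :
    q = alphaRoot q ^ 2 / (alphaRoot q + 1) := by
  have hα1 := one_lt_alphaRoot hq
  rw [eq_div_iff (by positivity), alphaRoot_sq (by linarith)]
  ring

/-- Parametrising by `α`, with `q = α² / (α + 1)`, turns the radicand of `aOne` into a perfect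
square. -/
theorem aOne_eq_alphaRoot {q : ℝ} (hq : 1 / 2 < q) :
    aOne (1 + q) = (alphaRoot q + 1) ^ 2 / (4 * alphaRoot q) := by
  have hα1 := one_lt_alphaRoot hq
  have hqα := q_eq_alphaRoot hq
  set α := alphaRoot q with hα
  have hα0 : 0 < α := by linarith
  have hnn : 0 ≤ 2 * (α + 1) ^ 2 / α - (q + 3) := by
    have : 2 * (α + 1) ^ 2 / α - (q + 3) = (α ^ 3 + 3 * α ^ 2 + 3 * α + 2) / (α * (α + 1)) := by
      rw [hqα]; field_simp; ring
    rw [this]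
    positivity
  have h : sqrt ((1 + q + 2) ^ 2 + 4 / (1 + q - 1)) = 2 * (α + 1) ^ 2 / α - (q + 3) := by
    rw [← sqrt_sq hnn]
    congr 1
    rw [add_sub_cancel_left, hqα]
    field_simp
    ring
  rw [aOne, h]
  field_simp
  ring

theorem atomPoint_eq {q s : ℝ} (hq : 1 / 2 < q) :
    atomPoint q s = s * (sqrt (alphaRoot q))⁻¹ * (alphaRoot q + 1) := by
  have hα1 := one_lt_alphaRoot hq
  have h4 : sqrt (4 * alphaRoot q) = 2 * sqrt (alphaRoot q) := by
    rw [sqrt_mul (by norm_num), show (4 : ℝ) = 2 ^ 2 by norm_num, sqrt_sq (by norm_num)]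
  rw [atomPoint, aOne_eq_alphaRoot hq, sqrt_div (by positivity), sqrt_sq (by positivity), h4]
  field_simp

/-- At `x = s (√α + 1/√α)` the constant-coefficient recurrence has the geometric solutions of ratios
`s/√α` and `s√α`. The equation `α² = qα + q` says exactly that the initial values select the first.
-/
theorem eval_atomPoint_jacobiPoly_succ {q s : ℝ} (hq : 1 / 2 < q) (n : ℕ) :
    (jacobiPoly (jacobiCoeff q s) (n + 3)).eval (atomPoint q s) =
      s * (sqrt (alphaRoot q))⁻¹ *
        (jacobiPoly (jacobiCoeff q s) (n + 2)).eval (atomPoint q s) := by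
  have hα1 := one_lt_alphaRoot hq
  have hα2 := alphaRoot_sq (q := q) (by linarith)
  have hx := atomPoint_eq (s := s) hq
  set α := alphaRoot q with hα
  set x := atomPoint q s with hxdef
  set z := (sqrt α)⁻¹ with hz
  have hz2 : z ^ 2 * α = 1 := by
    rw [hz, inv_pow, sq_sqrt (by linarith)]
    exact inv_mul_cancel₀ (by linarith)
  induction n with
  | zero =>
    simp only [jacobiPoly, jacobiCoeff, hx, eval_sub, eval_mul, eval_X, eval_C, eval_one]
    linear_combination s ^ 3 * z * (α + 1) ^ 2 * hz2 + s ^ 3 * z * hα2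
  | succ n ih =>
    have h := congrArg (eval x) (jacobiPoly_add_two (jacobiCoeff q s) (n + 2))
    simp only [eval_sub, eval_mul, eval_X, eval_C, jacobiCoeff] at h
    rw [show n + 1 + 3 = n + 2 + 2 by ring, h, show n + 2 + 1 = n + 3 by ring,
      show n + 1 + 2 = n + 3 by ring]
    linear_combination (jacobiPoly (jacobiCoeff q s) (n + 3)).eval x * hx + (s * z * α) * ih +
      s ^ 2 * (jacobiPoly (jacobiCoeff q s) (n + 2)).eval x * hz2

theorem atomMass_pos {q : ℝ} (hq : 1 / 2 < q) : 0 < atomMass q := by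
  have hα1 := one_lt_alphaRoot hq
  have h : 1 + q < sqrt (q * (q + 4)) := lt_sqrt_of_sq_lt (by nlinarith)
  have h' : (1 + q) / sqrt (q * (q + 4)) < 1 := (div_lt_one (by linarith)).2 h
  rw [atomMass]
  linarith

theorem atomMass_eq {q : ℝ} (hq : 1 / 2 < q) :
    atomMass q = (alphaRoot q - 1) / (2 * (alphaRoot q * (alphaRoot q + 2))) := by
  have hα1 := one_lt_alphaRoot hq
  have hqα := q_eq_alphaRoot hq
  rw [atomMass, sqrt_eq_alphaRoot]
  set α := alphaRoot q with hα
  have hR : 2 * α - q = α * (α + 2) / (α + 1) := by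
    rw [hqα]; field_simp; ring
  have hα0 : 0 < α := by linarith
  rw [hR, hqα]
  field_simp
  ring

theorem sinCoeff_three {q : ℝ} (hq : 1 / 2 < q) :
    sinCoeff q 3 =
      π / 2 * (1 - alphaRoot q) * (alphaRoot q + 1) / (alphaRoot q ^ 2 * (alphaRoot q + 2)) := by
  have hα1 := one_lt_alphaRoot hq
  have hqα := q_eq_alphaRoot hq
  obtain ⟨-, -, -, h⟩ := sinCoeff_of_half_lt hq
  set α := alphaRoot q with hα
  have hR : 2 * α - q = α * (α + 2) / (α + 1) := by
    rw [hqα]; field_simp; ring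
  rw [hR] at h
  rw [eq_div_iff (by positivity)]
  field_simp at h
  linear_combination h / 2

/-- The sum of the absolutely continuous part and the two atoms. -/
noncomputable def atomicLaw (q s : ℝ) : Measure ℝ :=
  densityMeasure q s + ENNReal.ofReal (atomMass q) •
    (Measure.dirac (-atomPoint q s) + Measure.dirac (atomPoint q s))

theorem isFiniteMeasure_atomicLaw {q s : ℝ} (hq : -1 < q) (hs : 0 < s) :
    IsFiniteMeasure (atomicLaw q s) := by
  have := isFiniteMeasure_densityMeasure hq hs
  have := (Measure.dirac (-atomPoint q s) + Measure.dirac (atomPoint q s)).smul_finite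
    (ENNReal.ofReal_ne_top (r := atomMass q))
  unfold atomicLaw
  infer_instance

theorem atomicLaw_compl_Icc {q s : ℝ} (hs : 0 < s) :
    atomicLaw q s (Set.Icc (-(2 * s + atomPoint q s)) (2 * s + atomPoint q s))ᶜ = 0 := by
  have hx : 0 ≤ atomPoint q s := by rw [atomPoint]; positivity
  have h1 : densityMeasure q s
      (Set.Icc (-(2 * s + atomPoint q s)) (2 * s + atomPoint q s))ᶜ = 0 :=
    measure_mono_null (Set.compl_subset_compl.2 (Set.Icc_subset_Icc (by linarith) (by linarith)))
      (densityMeasure_compl_Icc q s)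
  have h2 : -atomPoint q s ∈ Set.Icc (-(2 * s + atomPoint q s)) (2 * s + atomPoint q s) :=
    ⟨by linarith, by linarith⟩
  have h3 : atomPoint q s ∈ Set.Icc (-(2 * s + atomPoint q s)) (2 * s + atomPoint q s) :=
    ⟨by linarith, by linarith⟩
  simp only [atomicLaw, Measure.add_apply, Measure.smul_apply, h1,
    Measure.dirac_apply' _ measurableSet_Icc.compl, Set.indicator_of_notMem
      (Set.notMem_compl_iff.2 h2), Set.indicator_of_notMem (Set.notMem_compl_iff.2 h3)]
  simp

theorem integral_atomicLaw {q s : ℝ} (hq : 1 / 2 < q) (hs : 0 < s) (p : ℝ[X]) :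
    ∫ x, p.eval x ∂atomicLaw q s = ∫ x, p.eval x ∂densityMeasure q s +
      atomMass q * (p.eval (-atomPoint q s) + p.eval (atomPoint q s)) := by
  have := isFiniteMeasure_densityMeasure (q := q) (by linarith) hs
  have hd : ∀ y : ℝ, Integrable (fun x => p.eval x) (Measure.dirac y) := fun y =>
    integrable_dirac (by simp)
  rw [atomicLaw, integral_add_measure
    (integrable_eval_polynomial (densityMeasure_compl_Icc q s) p)
    (((hd _).add_measure (hd _)).smul_measure ENNReal.ofReal_ne_top), integral_smul_measure,
    integral_add_measure (hd _) (hd _), integral_dirac, integral_dirac,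
    ENNReal.toReal_ofReal (atomMass_pos hq).le, smul_eq_mul]

/-- The mass is `(2/π)(c_1 - q c_3)`, and both coefficients are explicit in `α`. -/
theorem integral_densityMeasure_one_of_half_lt {q s : ℝ} (hq : 1 / 2 < q) (hs : 0 < s) :
    ∫ _, (1 : ℝ) ∂densityMeasure q s = 1 - 2 * atomMass q := by
  have hα1 := one_lt_alphaRoot hq
  have hqα := q_eq_alphaRoot hq
  obtain ⟨-, -, h1, -⟩ := sinCoeff_of_half_lt hq
  rw [integral_densityMeasure_one (by linarith) hs, sub_eq_iff_eq_add.1 h1, sinCoeff_three hq,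
    atomMass_eq hq]
  set α := alphaRoot q with hα
  have hα0 : 0 < α := by linarith
  have hqα' : α - q = α / (α + 1) := by rw [hqα]; field_simp; ring
  have e : ∀ c : ℝ, π / 2 + α * c - q * c = π / 2 + α / (α + 1) * c := fun c => by
    rw [← hqα']; ring
  rw [e]
  field_simp
  ring

theorem integral_atomicLaw_one {q s : ℝ} (hq : 1 / 2 < q) (hs : 0 < s) :
    ∫ _, (1 : ℝ) ∂atomicLaw q s = 1 := by
  have h := integral_atomicLaw hq hs (1 : ℝ[X])
  simp only [eval_one] at h
  rw [h, integral_densityMeasure_one_of_half_lt hq hs]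
  ring

/-- Raising the degree by two multiplies both the density part and the atomic part by `s²/α`, so
only degrees two and three need checking. In odd degree both parts vanish: the even-indexed
coefficients are zero, and the atoms are symmetric. -/
theorem integral_atomicLaw_jacobiPoly {q s : ℝ} (hq : 1 / 2 < q) (hs : 0 < s) (n : ℕ) :
    ∫ x, (jacobiPoly (jacobiCoeff q s) (n + 2)).eval x ∂atomicLaw q s = 0 := by
  have hα1 := one_lt_alphaRoot hq
  have hqα := q_eq_alphaRoot hq
  obtain ⟨hrec, h2, -, -⟩ := sinCoeff_of_half_lt hq
  rw [integral_atomicLaw hq hs, integral_densityMeasure_jacobiPoly (by linarith) hs,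
    eval_neg_jacobiPoly]
  have hz2 : ((sqrt (alphaRoot q))⁻¹) ^ 2 = (alphaRoot q)⁻¹ := by
    rw [inv_pow, sq_sqrt (by linarith)]
  have hα0 : 0 < alphaRoot q := by linarith
  induction n using Nat.twoStepInduction with
  | zero =>
    have hx : (jacobiPoly (jacobiCoeff q s) (0 + 2)).eval (atomPoint q s) =
        s ^ 2 * ((alphaRoot q + 1) ^ 2 / alphaRoot q - 1) := by
      simp only [jacobiPoly, jacobiCoeff, eval_sub, eval_mul, eval_X, eval_C, eval_one,
        atomPoint_eq hq]
      linear_combination s ^ 2 * (alphaRoot q + 1) ^ 2 * hz2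
    rw [hx, atomMass_eq hq]
    simp only [zero_add, Nat.cast_ofNat]
    rw [sinCoeff_three hq]
    set α := alphaRoot q with hα
    rw [hqα]
    field_simp
    ring
  | one =>
    have h4 : sinCoeff q 4 = 0 := by
      have h := hrec 2 le_rfl
      rw [h2] at h
      exact (mul_eq_zero.1 h.symm).resolve_left hα0.ne'
    norm_num [h4]
  | more n h0 _ =>
    have hc := hrec (n + 3 : ℕ) (by omega)
    rw [show ((n + 3 : ℕ) : ℤ) + 2 = ((n + 2 + 3 : ℕ) : ℤ) by push_cast; ring] at hc
    have hx : (jacobiPoly (jacobiCoeff q s) (n + 2 + 2)).eval (atomPoint q s) =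
        s ^ 2 * (alphaRoot q)⁻¹ *
          (jacobiPoly (jacobiCoeff q s) (n + 2)).eval (atomPoint q s) := by
      rw [show n + 2 + 2 = n + 1 + 3 by ring, eval_atomPoint_jacobiPoly_succ hq,
        show n + 1 + 2 = n + 3 by ring, eval_atomPoint_jacobiPoly_succ hq, ← hz2]
      ring
    rw [hc] at h0
    rw [hx]
    have e : alphaRoot q * (alphaRoot q)⁻¹ = 1 := mul_inv_cancel₀ hα0.ne'
    linear_combination s ^ 2 * (alphaRoot q)⁻¹ * h0 -
      2 * (1 + q) / π * s ^ (n + 2 + 2) * sinCoeff q (n + 2 + 3 : ℕ) * e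

theorem fieldLaw_eq_atomicLaw {H : Type u} [NormedAddCommGroup H] [InnerProductSpace ℂ H]
    (q : Set.Icc (-1 : ℝ) 1) (hq : 1 / 2 < (q : ℝ)) {f : H} (hf : f ≠ 0) :
    fieldLaw q f = atomicLaw q ‖f‖ := by
  have hs : 0 < ‖f‖ := norm_pos_iff.2 hf
  have hq1 : -1 < (q : ℝ) := by linarith
  have := isFiniteMeasure_atomicLaw hq1 hs
  refine fieldLaw_eq_of_jacobiPoly q f _ (atomicLaw_compl_Icc hs) ?_ ?_
    (integral_atomicLaw_jacobiPoly hq hs)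
  · exact integral_atomicLaw_one hq hs
  · have h := integral_atomicLaw hq hs (X : ℝ[X])
    simp only [eval_X] at h
    obtain ⟨-, h2, -, -⟩ := sinCoeff_of_half_lt hq
    rw [h, integral_densityMeasure_id hq1 hs, h2]
    ring

end Atoms

/-! ### Total mass and conclusion -/

theorem isProbabilityMeasure_fieldLaw {H : Type u} [NormedAddCommGroup H] [InnerProductSpace ℂ H]
    (q : Set.Icc (-1 : ℝ) 1) (hq : -1 < (q : ℝ)) {f : H} (hf : f ≠ 0) :
    IsProbabilityMeasure (fieldLaw q f) := by
  have hs : 0 < ‖f‖ := norm_pos_iff.2 hf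
  rcases le_or_gt (q : ℝ) (1 / 2) with hq' | hq'
  · have := isFiniteMeasure_densityMeasure hq hs
    have h := integral_densityMeasure_of_le_half hq hq' hs
    rw [integral_const, smul_eq_mul, mul_one] at h
    rw [fieldLaw_eq_densityMeasure q hq hq' hf]
    exact ⟨(ENNReal.toReal_eq_one_iff _).1 h⟩
  · have h := integral_atomicLaw_one hq' hs
    rw [integral_const, smul_eq_mul, mul_one] at h
    rw [fieldLaw_eq_atomicLaw q hq' hf]
    exact ⟨(ENNReal.toReal_eq_one_iff _).1 h⟩

end Q2Fock

theorem theorem3p4 {H : Type*} [NormedAddCommGroup H] [InnerProductSpace ℂ H] [CompleteSpace H]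
    (q : Set.Icc (-1 : ℝ) 1) (hq : -1 < (q : ℝ)) (f : H) (hf : f ≠ 0) :
    Measurable (Q2Fock.density q ‖f‖) ∧ (∀ x, 0 ≤ Q2Fock.density q ‖f‖ x) ∧
    IsProbabilityMeasure (Q2Fock.fieldLaw q f) ∧
    ((q : ℝ) ≤ 1 / 2 →
      ∫⁻ x, ENNReal.ofReal (Q2Fock.density q ‖f‖ x) = 1 ∧
      Q2Fock.fieldLaw q f ≪ volume ∧
      Q2Fock.fieldLaw q f =
        volume.withDensity (fun x => ENNReal.ofReal (Q2Fock.density q ‖f‖ x))) ∧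
    (1 / 2 < (q : ℝ) →
      ∫⁻ x, ENNReal.ofReal (Q2Fock.density q ‖f‖ x) ≠ 1 ∧
      Q2Fock.fieldLaw q f =
        volume.withDensity (fun x => ENNReal.ofReal (Q2Fock.density q ‖f‖ x)) +
          ENNReal.ofReal (1 / 2 * (1 - (1 + (q : ℝ)) / Real.sqrt ((q : ℝ) * ((q : ℝ) + 4)))) •
            (Measure.dirac (-(2 * ‖f‖ * Real.sqrt (Q2Fock.aOne (1 + (q : ℝ))))) +
              Measure.dirac (2 * ‖f‖ * Real.sqrt (Q2Fock.aOne (1 + (q : ℝ)))))) := by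
  have hs : 0 < ‖f‖ := norm_pos_iff.2 hf
  have := Q2Fock.isFiniteMeasure_densityMeasure hq hs
  have huniv : ∫⁻ x, ENNReal.ofReal (Q2Fock.density q ‖f‖ x) =
      Q2Fock.densityMeasure q ‖f‖ Set.univ := by
    rw [Q2Fock.densityMeasure, withDensity_apply _ MeasurableSet.univ, Measure.restrict_univ]
  have hprob : IsProbabilityMeasure (Q2Fock.fieldLaw q f) :=
    Q2Fock.isProbabilityMeasure_fieldLaw q hq hf
  refine ⟨Q2Fock.measurable_density q ‖f‖, Q2Fock.density_nonneg hq hs, hprob,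
    fun hq' => ?_, fun hq' => ⟨fun h => ?_, Q2Fock.fieldLaw_eq_atomicLaw q hq' hf⟩⟩
  · have h := Q2Fock.fieldLaw_eq_densityMeasure q hq hq' hf
    refine ⟨?_, ?_, h⟩
    · rw [huniv, ← h, measure_univ]
    · rw [h]
      exact withDensity_absolutelyContinuous _ _
  -- The density has mass `1 - 2 * atomMass q`, and the atoms have positive mass.
  · have h1 := Q2Fock.integral_densityMeasure_one_of_half_lt hq' hs
    rw [huniv] at h
    rw [integral_const, measureReal_def, h] at h1
    have := Q2Fock.atomMass_pos hq'
    norm_num at h1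
    linarith
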